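/- **Theorem 2.6** (Overcrowding for the spectrum of Laplacian matrices). For every $p\in(0,1)$ there exist constants $C\ge 1$, $c>0$, $K>0$ and $a>0$, depending only on $p$, such that the following holds for all integers $n\ge 2$, all integers $k$ with $C\log n\le k\le n$, and all deterministic real $n\times n$ matrices $F$. Let $G$ be an Erdős–Rényi random graph $G(n,p)$ (each of the $\binom n2$ possible edges on $n$ labelled vertices is present independently with probability $p$), and let $L_n=D_n-A_n$ be its Laplacian, where $A_n$ is the adjacency matrix and $D_n$ is the diagonal matrix of vertex degrees. Write $\sigma_1(M)\ge\sigma_2(M)\ge\dots\ge\sigma_n(M)\ge 0$ for the singular values of an $n\times n$ matrix $M$, counted with multiplicity. Then $$\mathbb{P}\left(\sigma_{n-k+1}(L_n+F)\le \frac{ck}{\sqrt n}\right)\le K\exp\left(-a\,\frac{k^{3/2}}{\log n}\right).$$ -/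

import Mathlib

noncomputable section

/-- The combinatorial Laplacian `D - A` of a graph on `n` vertices, with real entries. -/
def graphLaplacian {n : ℕ} (G : SimpleGraph (Fin n)) : Matrix (Fin n) (Fin n) ℝ :=
  letI : DecidableRel G.Adj := Classical.decRel G.Adj
  G.lapMatrix ℝ

/-- The `j`-th largest singular value (`1 ≤ j ≤ n`, counted with multiplicity, so that
`σ₁ ≥ σ₂ ≥ ⋯ ≥ σₙ ≥ 0`) of a real `n × n` matrix acting on Euclidean space.
Mathlib's sequence of singular values is also decreasing, but is indexed from zero. -/
def singularValue {n : ℕ} (M : Matrix (Fin n) (Fin n) ℝ) (j : ℕ) : ℝ :=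
  (Matrix.toEuclideanLin M).singularValues (j - 1)

end

/-!
The bound proved here is `exp (-a k ^ 2)`, which is stronger than the claimed one. Write
`M = L + F`, `δ = c k / √n`, and let `q` be about `k / 4`.

If `M` has `k` singular values that are at most `δ`, it contracts a `k`-dimensional space by the
factor `δ`. Choosing `2 q` coordinates at which the projections of the unit vectors to that space
span the largest volume gives dual vectors of norm `O(√(n / k))` inside the space
(`exists_dual_family`). The chosen vertices come in `q` pairs. The compression of `M` to the
remaining coordinates still has a space `W` of left vectors, of dimension at least `2 q`, on which
it is bounded by `δ` (`exists_dual_family_and_left_subspace`). Testing `M v`, for a dual vector `v`,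
against `W` shows that the column of `M` at each chosen vertex has a projection to `W` of norm
`O(c √k)`, although it typically has norm of order `√k` (`norm_starProjection_apply_single_le`).

The degrees on the diagonal of `L` depend on the chosen columns, so these are not independent of
`W`. The randomness that is left is that of swaps: exchanging the edges from an outside vertex `j`
to the two members of a pair preserves the law of the graph
(`binomialRandom_real_singleton_twist`) and all degrees outside the pairs, hence also `W`
(`graphLaplacian_twist_swapPairs`). Under independent random swaps the difference of two paired
columns becomes a sum with random signs, and its projection to `W` obeys a small-ball estimate
(`sum_exp_neg_norm_sub_sum_sign_le`). The resulting exponent is a weighted sum, over the outside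
vertices `j`, of the number of pairs that `j` distinguishes, with weights in `[0, 1]` of total mass
`dim W`. It is at least the unweighted sum over some `2 q` vertices
(`exists_subset_sum_le_sum_mul`), whose exponential moment is explicit because the edges are
independent (`integral_exp_neg_discordance`). For fixed pairs this gives `exp (-a k ^ 2)`, up to
`n ^ (2 q)` choices of the `2 q` vertices. A union bound over the pairs costs another factor
`n ^ (2 q)`, and both factors are absorbed since `k ≥ C log n`.
-/

open Module MeasureTheory ProbabilityTheory

/-! ### Singular subspaces -/

/-- Small right singular vectors: if the singular value with index `n - k` (counted from zero) of
`T` is at most `δ`, then `T` contracts a `k`-dimensional subspace by the factor `δ`. -/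
theorem exists_submodule_norm_apply_le {E F : Type*} [NormedAddCommGroup E]
    [InnerProductSpace ℝ E] [FiniteDimensional ℝ E] [NormedAddCommGroup F]
    [InnerProductSpace ℝ F] [FiniteDimensional ℝ F] (T : E →ₗ[ℝ] F) {n k : ℕ}
    (hn : finrank ℝ E = n) (hk : k ≤ n) {δ : ℝ}
    (hδ : T.singularValues (n - k) ≤ δ) :
    ∃ V : Submodule ℝ E, finrank ℝ V = k ∧ ∀ v ∈ V, ‖T v‖ ≤ δ * ‖v‖ := by
  have hδ0 : 0 ≤ δ := (T.singularValues_nonneg _).trans hδ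
  set hS := T.isSymmetric_adjoint_comp_self
  set b := hS.eigenvectorBasis hn
  have key : ∀ v, ‖T v‖ ^ 2 = ∑ i : Fin n, T.singularValues i ^ 2 * inner ℝ (b i) v ^ 2 := by
    intro v
    have h1 : ‖T v‖ ^ 2 = inner ℝ ((LinearMap.adjoint T ∘ₗ T) v) v := by
      rw [LinearMap.comp_apply, LinearMap.adjoint_inner_left, real_inner_self_eq_norm_sq]
    rw [h1, ← b.sum_inner_mul_inner]
    refine Finset.sum_congr rfl fun i _ => ?_
    rw [hS, hS.apply_eigenvectorBasis hn i, T.sq_singularValues_fin hn i,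
      inner_smul_right, real_inner_comm v]
    simp only [RCLike.ofReal_real_eq_id, id_eq, b]
    ring
  let f : Fin k → Fin n := fun i => ⟨n - k + i, by omega⟩
  have hf : Function.Injective f := by
    intro i j h
    simp only [f, Fin.mk.injEq] at h
    exact Fin.ext (by omega)
  refine ⟨Submodule.span ℝ (Set.range (b ∘ f)), ?_, ?_⟩
  · rw [finrank_span_eq_card (b.orthonormal.comp f hf).linearIndependent, Fintype.card_fin]
  · intro v hv
    have hz : ∀ i : Fin n, (i : ℕ) < n - k → inner ℝ (b i) v = 0 := by
      intro i hi
      induction hv using Submodule.span_induction with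
      | mem x hx =>
        obtain ⟨j, rfl⟩ := hx
        rw [Function.comp_apply, b.inner_eq_ite, if_neg]
        rintro rfl
        simp [f] at hi
      | zero => simp
      | add x y _ _ hx hy => rw [inner_add_right, hx, hy, add_zero]
      | smul a x _ hx => rw [inner_smul_right, hx, mul_zero]
    refine abs_le_of_sq_le_sq' ?_ (by positivity) |>.2
    rw [key, mul_pow, ← b.sum_sq_inner_right v, Finset.mul_sum]
    refine Finset.sum_le_sum fun i _ => ?_
    by_cases hi : (i : ℕ) < n - k
    · simp [hz i hi]
    · gcongr
      · exact T.singularValues_nonneg _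
      · exact (T.singularValues_antitone (by omega)).trans hδ

/-- Small left singular vectors: if `T` contracts a subspace `V` by the factor `δ`, then so does
its adjoint on a subspace of at least the same dimension. The conclusion is phrased through the
bilinear form of `T`. -/
theorem exists_submodule_inner_apply_le {E : Type*} [NormedAddCommGroup E]
    [InnerProductSpace ℝ E] [FiniteDimensional ℝ E] (T : E →ₗ[ℝ] E) {δ : ℝ} (hδ0 : 0 ≤ δ)
    (V : Submodule ℝ E) (hV : ∀ v ∈ V, ‖T v‖ ≤ δ * ‖v‖) :
    ∃ W : Submodule ℝ E, finrank ℝ V ≤ finrank ℝ W ∧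
      ∀ w ∈ W, ∀ u, |inner ℝ w (T u)| ≤ δ * ‖w‖ * ‖u‖ := by
  obtain ⟨n, hn⟩ : ∃ n, finrank ℝ E = n := ⟨_, rfl⟩
  set hS := T.isSymmetric_adjoint_comp_self
  set b := hS.eigenvectorBasis hn
  have hTb : ∀ i j, inner ℝ (T (b i)) (T (b j)) =
      if i = j then T.singularValues i ^ 2 else 0 := by
    intro i j
    rw [← LinearMap.adjoint_inner_right, ← LinearMap.comp_apply,
      hS.apply_eigenvectorBasis hn j, inner_smul_right, b.inner_eq_ite,
      ← T.sq_singularValues_fin hn j]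
    split_ifs with h
    · subst h; simp
    · simp
  have key : ∀ c : Fin n → ℝ, ‖T (∑ i, c i • b i)‖ ^ 2 =
      ∑ i : Fin n, T.singularValues i ^ 2 * c i ^ 2 := by
    intro c
    rw [← real_inner_self_eq_norm_sq, map_sum, sum_inner]
    refine Finset.sum_congr rfl fun i _ => ?_
    rw [inner_sum, Finset.sum_eq_single i]
    · rw [map_smul, inner_smul_left, inner_smul_right, hTb]; simp; ring
    · intro j _ hj
      rw [map_smul, map_smul, inner_smul_left, inner_smul_right, hTb, if_neg hj.symm]; simp
    · simp
  have keyn : ∀ c : Fin n → ℝ, ‖∑ i, c i • b i‖ ^ 2 = ∑ i, c i ^ 2 := by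
    intro c
    rw [← b.sum_sq_inner_right]
    refine Finset.sum_congr rfl fun i _ => ?_
    rw [b.orthonormal.inner_right_fintype]
  let J := {i : Fin n // δ < T.singularValues i}
  let Ebig : Submodule ℝ E := Submodule.span ℝ (Set.range fun j : J => b j)
  have hEbig : finrank ℝ Ebig = Fintype.card J :=
    finrank_span_eq_card (b.orthonormal.comp _ Subtype.val_injective).linearIndependent
  have hdisj : V ⊓ Ebig = ⊥ := by
    rw [eq_bot_iff]
    rintro x ⟨hxV, hxE⟩
    have hc : ∀ i : Fin n, T.singularValues i ≤ δ → inner ℝ (b i) x = 0 := by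
      intro i hi
      have hxE' : x ∈ Submodule.span ℝ (Set.range fun j : J => b j) := hxE
      clear hxE hxV
      induction hxE' using Submodule.span_induction with
      | mem x hx =>
        obtain ⟨⟨j, hj⟩, rfl⟩ := hx
        rw [b.inner_eq_ite, if_neg]
        rintro rfl
        exact absurd hi (not_le.2 hj)
      | zero => simp
      | add x y _ _ hx hy => rw [inner_add_right, hx, hy, add_zero]
      | smul a x _ hx => rw [inner_smul_right, hx, mul_zero]
    have h1 := hV x hxV
    rw [← b.sum_repr' x] at h1
    have h2 := pow_le_pow_left₀ (norm_nonneg _) h1 2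
    rw [mul_pow, key, keyn, Finset.mul_sum] at h2
    have h3 : ∀ i ∈ Finset.univ, δ ^ 2 * inner ℝ (b i) x ^ 2 ≤
        T.singularValues i ^ 2 * inner ℝ (b i) x ^ 2 := by
      intro i _
      by_cases hi : T.singularValues i ≤ δ
      · simp [hc i hi]
      · push Not at hi
        gcongr
    have h4 := (Finset.sum_eq_sum_iff_of_le h3).1 (le_antisymm (Finset.sum_le_sum h3) h2)
    have h5 : ∀ i, inner ℝ (b i) x = 0 := by
      intro i
      by_cases hi : T.singularValues i ≤ δ
      · exact hc i hi
      · push Not at hi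
        have h6 := h4 i (Finset.mem_univ _)
        have h7 : δ ^ 2 < T.singularValues i ^ 2 := by gcongr
        by_contra h8
        have h9 : 0 < inner ℝ (b i) x ^ 2 := by positivity
        nlinarith
    rw [Submodule.mem_bot, ← b.sum_repr' x]
    simp [h5]
  refine ⟨(Ebig.map T)ᗮ, ?_, ?_⟩
  · have h1 := Submodule.finrank_sup_add_finrank_inf_eq V Ebig
    rw [hdisj, finrank_bot] at h1
    have h2 := Submodule.finrank_le (V ⊔ Ebig)
    have h3 := (Ebig.map T).finrank_add_finrank_orthogonal
    have h4 := Submodule.finrank_map_le T Ebig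
    omega
  · intro w hw u
    classical
    let c : Fin n → ℝ := fun i => if T.singularValues i ≤ δ then inner ℝ (b i) u else 0
    have h1 : inner ℝ w (T u) = inner ℝ w (T (∑ i, c i • b i)) := by
      conv_lhs => rw [← b.sum_repr' u]
      rw [map_sum, map_sum, inner_sum, inner_sum]
      refine Finset.sum_congr rfl fun i _ => ?_
      simp only [c]
      split_ifs with hi
      · rfl
      · push Not at hi
        rw [map_smul, inner_smul_right, zero_smul, map_zero, inner_zero_right]
        rw [(Submodule.mem_orthogonal' _ _).1 hw, mul_zero]
        exact Submodule.mem_map_of_mem (Submodule.subset_span ⟨⟨i, hi⟩, rfl⟩)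
    have h2 : ‖T (∑ i, c i • b i)‖ ≤ δ * ‖u‖ := by
      refine abs_le_of_sq_le_sq' ?_ (by positivity) |>.2
      rw [key, mul_pow, ← b.sum_sq_inner_right u, Finset.mul_sum]
      refine Finset.sum_le_sum fun i _ => ?_
      simp only [c]
      split_ifs with hi
      · gcongr
        exact T.singularValues_nonneg _
      · rw [zero_pow two_ne_zero, mul_zero]; positivity
    rw [h1]
    calc _ ≤ ‖w‖ * ‖T (∑ i, c i • b i)‖ := abs_real_inner_le_norm _ _
      _ ≤ ‖w‖ * (δ * ‖u‖) := by gcongr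
      _ = _ := by ring

/-! ### Coordinates in general position -/

section

variable {E : Type*} [NormedAddCommGroup E] [InnerProductSpace ℝ E]
variable {κ : Type*} [Fintype κ] [DecidableEq κ]

/-- Adding to one vector a combination of the others does not change the Gram determinant. -/
theorem det_gram_update_add_of_mem_span (z : κ → E) (a : κ) (x h : E)
    (hh : h ∈ Submodule.span ℝ (Set.range (Function.update z a 0))) :
    (Matrix.gram ℝ (Function.update z a (x + h))).det =
      (Matrix.gram ℝ (Function.update z a x)).det := by
  obtain ⟨c, rfl⟩ := (Submodule.mem_span_range_iff_exists_fun ℝ).1 hh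
  set A : Matrix κ κ ℝ := (1 : Matrix κ κ ℝ).updateRow a (Function.update c a 1) with hA
  have hdet : A.det = 1 := by
    have := Matrix.cramer_transpose_apply (1 : Matrix κ κ ℝ) (Function.update c a 1) a
    rw [Matrix.transpose_one, Matrix.cramer_one] at this
    rw [hA, ← this]
    simp
  have hz : ∀ i, Function.update z a (x + ∑ j, c j • Function.update z a 0 j) i =
      ∑ j, A i j • Function.update z a x j := by
    intro i
    by_cases hi : i = a
    · subst hi
      rw [Function.update_self, hA, ← Finset.add_sum_erase _ _ (Finset.mem_univ i),
        ← Finset.add_sum_erase (a := i) _ (fun j => Matrix.updateRow _ _ _ i j • _)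
          (Finset.mem_univ i)]
      simp only [Function.update_self, smul_zero, zero_add, Matrix.updateRow_self, one_smul]
      congr 1
      refine Finset.sum_congr rfl fun j hj => ?_
      have hj' := (Finset.mem_erase.1 hj).1
      rw [Function.update_of_ne hj', Function.update_of_ne hj', Function.update_of_ne hj']
    · rw [Function.update_of_ne hi, Finset.sum_eq_single i]
      · rw [hA, Matrix.updateRow_ne hi, Matrix.one_apply_eq, one_smul, Function.update_of_ne hi]
      · intro j _ hj
        rw [hA, Matrix.updateRow_ne hi, Matrix.one_apply_ne hj.symm, zero_smul]
      · simp
  have hG : Matrix.gram ℝ (Function.update z a (x + ∑ j, c j • Function.update z a 0 j)) =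
      A * Matrix.gram ℝ (Function.update z a x) * A.transpose := by
    ext i j
    rw [Matrix.gram_apply, hz, hz, inner_sum, Matrix.mul_apply]
    refine Finset.sum_congr rfl fun l _ => ?_
    rw [sum_inner, Matrix.mul_apply, Matrix.transpose_apply, Finset.sum_mul]
    refine Finset.sum_congr rfl fun m _ => ?_
    rw [inner_smul_left, inner_smul_right, Matrix.gram_apply]
    simp only [conj_trivial]
    ring
  rw [hG, Matrix.det_mul, Matrix.det_mul, Matrix.det_transpose, hdet, one_mul, mul_one]

/-- If `w` is orthogonal to the other vectors, then it contributes the factor `‖w‖ ^ 2` to the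
Gram determinant; the remaining factor does not involve `w`. -/
theorem det_gram_update_of_orthogonal (z : κ → E) (a : κ) (w : E)
    (hw : ∀ b, b ≠ a → inner ℝ (z b) w = 0) :
    (Matrix.gram ℝ (Function.update z a w)).det = ‖w‖ ^ 2 *
      ((Matrix.gram ℝ (Function.update z a 0)).updateRow a (Pi.single a 1)).det := by
  have h1 : Matrix.gram ℝ (Function.update z a w) =
      (Matrix.gram ℝ (Function.update z a 0)).updateRow a (‖w‖ ^ 2 • Pi.single a 1) := by
    ext i j
    by_cases hi : i = a
    · subst hi
      by_cases hj : j = i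
      · subst hj
        simp [Matrix.gram_apply]
      · rw [Matrix.updateRow_self, Matrix.gram_apply, Function.update_self,
          Function.update_of_ne hj, real_inner_comm, hw j hj]
        simp [hj]
    · rw [Matrix.updateRow_ne hi, Matrix.gram_apply, Matrix.gram_apply, Function.update_of_ne hi,
        Function.update_of_ne hi]
      by_cases hj : j = a
      · subst hj
        rw [Function.update_self, Function.update_self, hw i hi, inner_zero_right]
      · rw [Function.update_of_ne hj, Function.update_of_ne hj]
  rw [h1, Matrix.det_updateRow_smul]

end

section

variable {ι : Type*} [Fintype ι] [DecidableEq ι]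

/-- The trace of an orthogonal projection is its rank. -/
theorem sum_norm_sq_starProjection_single (W : Submodule ℝ (EuclideanSpace ℝ ι)) :
    ∑ j, ‖W.starProjection (EuclideanSpace.single j 1)‖ ^ 2 = finrank ℝ W := by
  let g := stdOrthonormalBasis ℝ W
  have h1 : ∀ j, ‖W.starProjection (EuclideanSpace.single j 1)‖ ^ 2 =
      ∑ t, (g t : EuclideanSpace ℝ ι) j ^ 2 := by
    intro j
    have h2 : ‖W.starProjection (EuclideanSpace.single j 1)‖ =
        ‖W.orthogonalProjectionOnto (EuclideanSpace.single j 1)‖ := rfl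
    rw [h2, ← g.sum_sq_inner_right]
    refine Finset.sum_congr rfl fun t _ => ?_
    rw [Submodule.coe_inner, Submodule.coe_orthogonalProjectionOnto_apply,
      ← Submodule.inner_starProjection_left_eq_right,
      Submodule.starProjection_eq_self_iff.2 (g t).2, real_inner_comm,
      EuclideanSpace.inner_single_left]
    simp
  simp_rw [h1]
  rw [Finset.sum_comm]
  have h3 : ∀ t, ∑ j, (g t : EuclideanSpace ℝ ι) j ^ 2 = 1 := by
    intro t
    rw [← EuclideanSpace.real_norm_sq_eq, Submodule.norm_coe, g.orthonormal.1, one_pow]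
  simp [h3]

/-- A Hilbert–Schmidt form of restricted invertibility: a subspace `V` of dimension at least
`card κ` has coordinates `f`, indexed by `κ`, whose dual vectors `v` inside `V` are short.
The coordinates are those for which the projections of the unit vectors to `V` span the largest
volume, so that none of them is closer to the span of the others than an average unit vector. -/
theorem exists_dual_family {κ : Type*} [Fintype κ] [DecidableEq κ]
    (V : Submodule ℝ (EuclideanSpace ℝ ι)) (hκ : Fintype.card κ ≤ finrank ℝ V) :
    ∃ f : κ → ι, Function.Injective f ∧ ∃ v : κ → EuclideanSpace ℝ ι,
      (∀ a, v a ∈ V) ∧ (∀ a b, v a (f b) = if a = b then 1 else 0) ∧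
      ∀ a, ‖v a‖ ^ 2 * ((finrank ℝ V : ℝ) - Fintype.card κ) ≤ Fintype.card ι := by
  set q : ι → EuclideanSpace ℝ ι := fun j => V.starProjection (EuclideanSpace.single j 1) with hq
  have hqV : ∀ j, q j ∈ V := fun j => V.starProjection_apply_mem _
  have hqi : ∀ j, ∀ v ∈ V, inner ℝ (q j) v = v j := by
    intro j v hv
    rw [hq, Submodule.inner_starProjection_left_eq_right,
      Submodule.starProjection_eq_self_iff.2 hv, EuclideanSpace.inner_single_left]
    simp
  have hspan : Submodule.span ℝ (Set.range q) = V := by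
    refine le_antisymm (Submodule.span_le.2 ?_) ?_
    · rintro _ ⟨j, rfl⟩
      exact hqV j
    · intro v hv
      have h1 : v = ∑ j, v j • q j := by
        conv_lhs => rw [← Submodule.starProjection_eq_self_iff.2 hv,
          ← (EuclideanSpace.basisFun ι ℝ).sum_repr v]
        simp [hq, map_sum]
      rw [h1]
      exact Submodule.sum_mem _ fun j _ => Submodule.smul_mem _ _ (Submodule.subset_span ⟨j, rfl⟩)
  obtain ⟨f₀, hf₀⟩ : ∃ f₀ : κ → ι, LinearIndependent ℝ (q ∘ f₀) := by
    obtain ⟨g, hg, -, hgi⟩ := Submodule.exists_fun_fin_finrank_span_eq ℝ (Set.range q)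
    choose f₁ hf₁ using hg
    let e : κ ↪ Fin (finrank ℝ (Submodule.span ℝ (Set.range q))) :=
      (Fintype.equivFin κ).toEmbedding.trans (Fin.castLEEmb (by rwa [hspan]))
    refine ⟨f₁ ∘ e, ?_⟩
    have : q ∘ f₁ ∘ e = g ∘ e := funext fun i => hf₁ _
    rw [this]
    exact hgi.comp e e.injective
  obtain ⟨f, -, hf⟩ := Finset.exists_max_image Finset.univ
    (fun f : κ → ι => (Matrix.gram ℝ (q ∘ f)).det) ⟨f₀, Finset.mem_univ _⟩
  have hfpos : 0 < (Matrix.gram ℝ (q ∘ f)).det :=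
    (Matrix.posDef_gram_of_linearIndependent hf₀).det_pos.trans_le (hf f₀ (Finset.mem_univ _))
  let H : κ → Submodule ℝ (EuclideanSpace ℝ ι) := fun a =>
    Submodule.span ℝ (Set.range (Function.update (q ∘ f) a 0))
  have hqH : ∀ a b, b ≠ a → q (f b) ∈ H a := fun a b hb =>
    Submodule.subset_span ⟨b, by rw [Function.update_of_ne hb, Function.comp_apply]⟩
  have hHV : ∀ a, H a ≤ V := by
    intro a
    refine Submodule.span_le.2 ?_
    rintro _ ⟨b, rfl⟩
    by_cases hb : b = a
    · subst hb; simp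
    · rw [Function.update_of_ne hb]; exact hqV _
  let r : κ → ι → EuclideanSpace ℝ ι := fun a j => q j - (H a).starProjection (q j)
  have hrH : ∀ a j, ∀ h ∈ H a, inner ℝ h (r a j) = 0 := fun a j =>
    (Submodule.mem_orthogonal _ _).1 (Submodule.sub_starProjection_mem_orthogonal _)
  have hrV : ∀ a j, r a j ∈ V := fun a j =>
    V.sub_mem (hqV j) (hHV a (Submodule.starProjection_apply_mem _ _))
  -- Exchanging the coordinate `f a` for `j` multiplies the Gram determinant by a ratio of heights.
  have hdet : ∀ a j, (Matrix.gram ℝ (q ∘ Function.update f a j)).det = ‖r a j‖ ^ 2 *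
      ((Matrix.gram ℝ (Function.update (q ∘ f) a 0)).updateRow a (Pi.single a 1)).det := by
    intro a j
    rw [← det_gram_update_of_orthogonal (q ∘ f) a (r a j) fun b hb => hrH a j _ (hqH a b hb),
      ← det_gram_update_add_of_mem_span (q ∘ f) a (r a j) ((H a).starProjection (q j))
        (Submodule.starProjection_apply_mem _ _), sub_add_cancel, Function.comp_update]
  have hmax : ∀ a j, ‖r a j‖ ^ 2 ≤ ‖r a (f a)‖ ^ 2 := by
    intro a j
    have h1 := hf (Function.update f a j) (Finset.mem_univ _)
    have h2 := hdet a (f a)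
    rw [Function.update_eq_self] at h2
    rw [hdet, ← Function.update_eq_self a f, hdet, Function.update_eq_self] at h1
    rw [h2] at hfpos
    exact le_of_mul_le_mul_right h1 (pos_of_mul_pos_right hfpos (sq_nonneg _))
  have hpos : ∀ a, 0 < ‖r a (f a)‖ ^ 2 := by
    intro a
    have h2 := hdet a (f a)
    rw [Function.update_eq_self] at h2
    rw [h2] at hfpos
    exact lt_of_le_of_ne (sq_nonneg _) fun h => by simp [← h] at hfpos
  have hrq : ∀ a, inner ℝ (q (f a)) (r a (f a)) = ‖r a (f a)‖ ^ 2 := by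
    intro a
    have h1 : q (f a) = r a (f a) + (H a).starProjection (q (f a)) := (sub_add_cancel _ _).symm
    conv_lhs => rw [h1]
    rw [inner_add_left, hrH a _ _ (Submodule.starProjection_apply_mem _ _), add_zero,
      real_inner_self_eq_norm_sq]
  have hsum : ∀ a, (finrank ℝ V : ℝ) - Fintype.card κ ≤ Fintype.card ι * ‖r a (f a)‖ ^ 2 := by
    intro a
    set K := (H a)ᗮ ⊓ V with hK
    have h1 : finrank ℝ V ≤ Fintype.card κ + finrank ℝ K := by
      rw [← Submodule.finrank_add_inf_finrank_orthogonal (hHV a)]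
      exact Nat.add_le_add_right (finrank_range_le_card _) _
    have h2 : ∀ j, ‖K.starProjection (EuclideanSpace.single j 1)‖ ^ 2 ≤ ‖r a (f a)‖ ^ 2 := by
      intro j
      refine le_trans ?_ (hmax a j)
      set y := K.starProjection (EuclideanSpace.single j 1) with hy
      have hyK : y ∈ K := K.starProjection_apply_mem _
      have h3 : ‖y‖ ^ 2 = inner ℝ (r a j) y := by
        rw [← real_inner_self_eq_norm_sq]
        conv_lhs => rw [hy, Submodule.inner_starProjection_left_eq_right, ← hy,
          Submodule.starProjection_eq_self_iff.2 hyK]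
        rw [inner_sub_left, (Submodule.mem_orthogonal _ _).1 hyK.1 _
          (Submodule.starProjection_apply_mem _ _), sub_zero, hqi j y hyK.2,
          EuclideanSpace.inner_single_left]
        simp
      have h4 := real_inner_le_norm (r a j) y
      nlinarith [norm_nonneg y, norm_nonneg (r a j), sq_nonneg (‖r a j‖ - ‖y‖)]
    have h5 := sum_norm_sq_starProjection_single K
    have h6 : (finrank ℝ K : ℝ) ≤ Fintype.card ι * ‖r a (f a)‖ ^ 2 := by
      rw [← h5]
      refine (Finset.sum_le_card_nsmul _ _ _ fun j _ => h2 j).trans ?_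
      rw [nsmul_eq_mul, Finset.card_univ]
    have h7 : (finrank ℝ V : ℝ) ≤ Fintype.card κ + finrank ℝ K := by exact_mod_cast h1
    linarith
  have hv : ∀ a b, ((‖r a (f a)‖ ^ 2)⁻¹ • r a (f a)) (f b) = if a = b then 1 else 0 := by
    intro a b
    rw [PiLp.smul_apply, ← hqi (f b) _ (hrV a _), smul_eq_mul]
    split_ifs with h
    · subst h
      rw [hrq, inv_mul_cancel₀ (hpos a).ne']
    · rw [hrH a _ _ (hqH a b (Ne.symm h)), mul_zero]
  refine ⟨f, ?_, fun a => (‖r a (f a)‖ ^ 2)⁻¹ • r a (f a), fun a => V.smul_mem _ (hrV a _), hv, ?_⟩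
  · intro a b hab
    have h1 := hv a b
    rw [← hab, hv a a] at h1
    by_contra h
    simp [h] at h1
  · intro a
    have h1 := hpos a
    rw [norm_smul, mul_pow, norm_inv, Real.norm_of_nonneg h1.le, inv_pow, sq (‖r a (f a)‖ ^ 2),
      mul_inv, mul_assoc _ _ (‖r a (f a)‖ ^ 2), inv_mul_cancel₀ h1.ne', mul_one,
      inv_mul_le_iff₀ h1, mul_comm]
    exact hsum a

end

/-! ### A small-ball estimate for random signs -/

/-- The small-ball estimate for a positive semidefinite form `Q`, by induction on the number of
signs. Averaging over the sign in front of the vector `z = y 0` gains at least `Q z z / 2` in the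
exponent and replaces `Q` by the form `Q - Q z ⊗ Q z`, which is again positive semidefinite since
`Q z z ≤ 1`. -/
theorem sum_exp_neg_form_sub_sum_sign_le {E : Type*} [AddCommGroup E] [Module ℝ E] {n : ℕ}
    (Q : LinearMap.BilinForm ℝ E) (hsymm : ∀ u v, Q u v = Q v u) (hpos : ∀ x, 0 ≤ Q x x)
    (y : Fin n → E)
    (hy : ∀ c : Fin n → ℝ, Q (∑ i, c i • y i) (∑ i, c i • y i) ≤ ∑ i, c i ^ 2) (x : E) :
    ∑ ε : Fin n → Bool, Real.exp (-(Q (x - ∑ i, (if ε i then (1 : ℝ) else -1) • y i)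
        (x - ∑ i, (if ε i then (1 : ℝ) else -1) • y i) / 2)) ≤
      2 ^ n * Real.exp (-((∑ i, Q (y i) (y i)) / 4)) := by
  induction n generalizing Q with
  | zero =>
    simp only [Finset.univ_unique, Finset.univ_eq_empty, Finset.sum_empty, Finset.sum_singleton,
      sub_zero, pow_zero, zero_div, neg_zero, Real.exp_zero, one_mul, Real.exp_le_one_iff]
    linarith [hpos x]
  | succ n ih =>
    set z := y 0 with hz
    set Q' : LinearMap.BilinForm ℝ E := Q - (LinearMap.mul ℝ ℝ).compl₁₂ (Q z) (Q z) with hQ'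
    have hQ'a : ∀ u v, Q' u v = Q u v - Q z u * Q z v := fun u v => by
      simp [hQ']
    have hz1 : Q z z ≤ 1 := by
      have := hy (Pi.single 0 1)
      simpa [Fin.sum_univ_succ, ← hz] using this
    have hcs : ∀ u v, Q u v ^ 2 ≤ Q u u * Q v v := fun u v =>
      LinearMap.BilinForm.apply_sq_le_of_symm Q hpos ⟨fun u v => hsymm u v⟩ u v
    have hpos' : ∀ u, 0 ≤ Q' u u := by
      intro u
      rw [hQ'a]
      nlinarith [hcs z u, hpos u]
    have hsymm' : ∀ u v, Q' u v = Q' v u := by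
      intro u v
      rw [hQ'a, hQ'a, hsymm u v]
      ring
    have htail : ∀ c : Fin n → ℝ, Q (∑ i, c i • y i.succ) (∑ i, c i • y i.succ) ≤ ∑ i, c i ^ 2 := by
      intro c
      have := hy (Fin.cons 0 c)
      simpa [Fin.sum_univ_succ] using this
    have hy' : ∀ c : Fin n → ℝ, Q' (∑ i, c i • y i.succ) (∑ i, c i • y i.succ) ≤
        ∑ i, c i ^ 2 := by
      intro c
      rw [hQ'a]
      nlinarith [htail c, sq_nonneg (Q z (∑ i, c i • y i.succ))]
    -- The correction terms sum to at most `Q z z`, by Cauchy–Schwarz against `∑ Q z (y i) • y i`.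
    have hloss : ∑ i : Fin n, Q z (y i.succ) ^ 2 ≤ Q z z := by
      set s := ∑ i : Fin n, Q z (y i.succ) ^ 2 with hs
      have h1 := htail fun i => Q z (y i.succ)
      have h2 : Q z (∑ i : Fin n, Q z (y i.succ) • y i.succ) = s := by
        rw [map_sum, hs]
        refine Finset.sum_congr rfl fun i _ => ?_
        rw [map_smul, smul_eq_mul, sq]
      have h3 := hcs z (∑ i : Fin n, Q z (y i.succ) • y i.succ)
      rw [h2] at h3
      have h0 : 0 ≤ s := Finset.sum_nonneg fun i _ => sq_nonneg _
      have h4 : Q z z * Q (∑ i : Fin n, Q z (y i.succ) • y i.succ)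
          (∑ i : Fin n, Q z (y i.succ) • y i.succ) ≤ Q z z * s := by
        gcongr
        exact hpos z
      rcases h0.eq_or_lt with h | h
      · rw [← h]; exact hpos z
      · nlinarith
    have hstep : ∀ w, Real.exp (-(Q (w - z) (w - z) / 2)) + Real.exp (-(Q (w + z) (w + z) / 2)) ≤
        2 * Real.exp (-(Q z z / 2)) * Real.exp (-(Q' w w / 2)) := by
      intro w
      have e1 : Q (w - z) (w - z) = Q w w + Q z z - 2 * Q z w := by
        have := hsymm w z
        simp only [map_sub, LinearMap.sub_apply]
        linarith
      have e2 : Q (w + z) (w + z) = Q w w + Q z z + 2 * Q z w := by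
        have := hsymm w z
        simp only [map_add, LinearMap.add_apply]
        linarith
      have h1 := Real.cosh_le_exp_half_sq (Q z w)
      rw [Real.cosh_eq] at h1
      have h2 : Real.exp (-(Q (w - z) (w - z) / 2)) + Real.exp (-(Q (w + z) (w + z) / 2)) =
          2 * Real.exp (-((Q w w + Q z z) / 2)) *
            ((Real.exp (Q z w) + Real.exp (-(Q z w))) / 2) := by
        rw [e1, e2, mul_div_assoc', mul_assoc, mul_div_cancel_left₀ _ two_ne_zero, mul_add,
          ← Real.exp_add, ← Real.exp_add]
        congr 2 <;> ring
      rw [h2, hQ'a]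
      calc _ ≤ 2 * Real.exp (-((Q w w + Q z z) / 2)) * Real.exp (Q z w ^ 2 / 2) := by gcongr
        _ = _ := by
          rw [mul_assoc, mul_assoc, ← Real.exp_add, ← Real.exp_add]
          congr 2; ring
    rw [← (Fin.consEquiv fun _ : Fin (n + 1) => Bool).sum_comp, Fintype.sum_prod_type,
      Finset.sum_comm]
    have hpair : ∀ ε : Fin n → Bool, ∑ b : Bool,
        Real.exp (-(Q (x - ∑ i, (if (Fin.consEquiv fun _ : Fin (n + 1) => Bool) (b, ε) i
            then (1 : ℝ) else -1) • y i)
          (x - ∑ i, (if (Fin.consEquiv fun _ : Fin (n + 1) => Bool) (b, ε) i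
            then (1 : ℝ) else -1) • y i) / 2)) ≤
        2 * Real.exp (-(Q z z / 2)) *
          Real.exp (-(Q' (x - ∑ i, (if ε i then (1 : ℝ) else -1) • y i.succ)
            (x - ∑ i, (if ε i then (1 : ℝ) else -1) • y i.succ) / 2)) := by
      intro ε
      have h1 := hstep (x - ∑ i, (if ε i then (1 : ℝ) else -1) • y i.succ)
      have e1 : ∀ t : E, x - (z + t) = x - t - z := fun t => by abel
      have e2 : ∀ t : E, x - (-z + t) = x - t + z := fun t => by abel
      rw [Fintype.sum_bool]
      simp only [Fin.sum_univ_succ, Fin.consEquiv, Equiv.coe_fn_mk, Fin.cons_zero, Fin.cons_succ,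
        ← hz, if_true, one_smul, Bool.false_eq_true, if_false, neg_smul, e1, e2]
      exact h1
    refine (Finset.sum_le_sum fun ε _ => hpair ε).trans ?_
    rw [← Finset.mul_sum]
    refine (mul_le_mul_of_nonneg_left (ih Q' hsymm' hpos' _ hy') (by positivity)).trans ?_
    have hQs : ∑ i : Fin n, Q' (y i.succ) (y i.succ) =
        ∑ i : Fin n, Q (y i.succ) (y i.succ) - ∑ i : Fin n, Q z (y i.succ) ^ 2 := by
      rw [← Finset.sum_sub_distrib]
      refine Finset.sum_congr rfl fun i _ => ?_
      rw [hQ'a]; ring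
    rw [hQs, Fin.sum_univ_succ, ← hz]
    have : Real.exp (-(Q z z / 2)) * Real.exp (-((∑ i : Fin n, Q (y i.succ) (y i.succ) -
        ∑ i : Fin n, Q z (y i.succ) ^ 2) / 4)) ≤
        Real.exp (-((Q z z + ∑ i : Fin n, Q (y i.succ) (y i.succ)) / 4)) := by
      rw [← Real.exp_add]
      gcongr
      linarith
    calc _ = 2 ^ (n + 1) * (Real.exp (-(Q z z / 2)) *
          Real.exp (-((∑ i : Fin n, Q (y i.succ) (y i.succ) -
            ∑ i : Fin n, Q z (y i.succ) ^ 2) / 4))) := by ring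
      _ ≤ _ := by gcongr

/-- Small-ball estimate: if the vectors `y i` satisfy a Bessel inequality, then a random signed
sum of them is far from any prescribed point `x`, at the scale given by its mean square norm. -/
theorem sum_exp_neg_norm_sub_sum_sign_le {E ι : Type*} [NormedAddCommGroup E]
    [InnerProductSpace ℝ E] [Fintype ι] [DecidableEq ι] (y : ι → E)
    (hy : ∀ c : ι → ℝ, ‖∑ i, c i • y i‖ ^ 2 ≤ ∑ i, c i ^ 2) (x : E) :
    ∑ ε : ι → Bool, Real.exp (-(‖x - ∑ i, (if ε i then (1 : ℝ) else -1) • y i‖ ^ 2 / 2)) ≤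
      2 ^ Fintype.card ι * Real.exp (-((∑ i, ‖y i‖ ^ 2) / 4)) := by
  let e := Fintype.equivFin ι
  have h := sum_exp_neg_form_sub_sum_sign_le (innerₗ E) (fun u v => real_inner_comm _ _)
    (fun u => real_inner_self_nonneg) (y ∘ e.symm) (fun c => by
      have := hy (c ∘ e)
      rw [← e.symm.sum_comp, ← e.symm.sum_comp (fun i => (c ∘ e) i ^ 2)] at this
      simpa [-map_sum, real_inner_self_eq_norm_sq] using this) x
  rw [← (e.arrowCongr (Equiv.refl Bool)).sum_comp] at h
  simp only [innerₗ_apply_apply, real_inner_self_eq_norm_sq, Function.comp_apply] at h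
  rw [e.symm.sum_comp (fun i => ‖y i‖ ^ 2)] at h
  refine le_trans (Finset.sum_le_sum fun ε _ => le_of_eq ?_) h
  rw [← e.symm.sum_comp]
  simp

/-! ### Extreme points of a slice of the cube -/

/-- A weighted sum with weights in `[0, 1]` of total mass at least `d` dominates the sum of the
`d` smallest terms. -/
theorem exists_subset_sum_le_sum_mul {ι : Type*} [DecidableEq ι] (s : Finset ι) (r w : ι → ℝ)
    (hr : ∀ i ∈ s, 0 ≤ r i) (hw0 : ∀ i ∈ s, 0 ≤ w i) (hw1 : ∀ i ∈ s, w i ≤ 1) {d : ℕ}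
    (hd : (d : ℝ) ≤ ∑ i ∈ s, w i) :
    ∃ S ∈ s.powersetCard d, ∑ i ∈ S, r i ≤ ∑ i ∈ s, w i * r i := by
  have hds : d ≤ s.card := by
    have h1 : ∑ i ∈ s, w i ≤ s.card := by
      simpa using Finset.sum_le_sum hw1
    exact_mod_cast hd.trans h1
  obtain ⟨S, hS, hmin⟩ := Finset.exists_min_image (s.powersetCard d) (fun S => ∑ i ∈ S, r i)
    (Finset.powersetCard_nonempty.2 hds)
  refine ⟨S, hS, ?_⟩
  obtain ⟨hSs, hScard⟩ := Finset.mem_powersetCard.1 hS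
  have hswap : ∀ a ∈ S, ∀ b ∈ s \ S, r a ≤ r b := by
    intro a ha b hb
    obtain ⟨hbs, hbS⟩ := Finset.mem_sdiff.1 hb
    have hb' : b ∉ S.erase a := fun h => hbS (Finset.mem_of_mem_erase h)
    have h1 := hmin (insert b (S.erase a)) (Finset.mem_powersetCard.2
      ⟨Finset.insert_subset hbs ((Finset.erase_subset _ _).trans hSs), by
        rw [Finset.card_insert_of_notMem hb', Finset.card_erase_add_one ha, hScard]⟩)
    rw [Finset.sum_insert hb'] at h1
    have h2 := Finset.add_sum_erase S r ha
    linarith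
  rcases S.eq_empty_or_nonempty with rfl | hne
  · simp only [Finset.sum_empty]
    exact Finset.sum_nonneg fun i hi => mul_nonneg (hw0 i hi) (hr i hi)
  obtain ⟨a, ha, hmax⟩ := Finset.exists_max_image S r hne
  have h1 : ∑ i ∈ s, w i * r i = ∑ i ∈ s \ S, w i * r i + ∑ i ∈ S, w i * r i :=
    (Finset.sum_sdiff hSs).symm
  have h2 : ∑ i ∈ s \ S, w i * r a ≤ ∑ i ∈ s \ S, w i * r i :=
    Finset.sum_le_sum fun i hi =>
      mul_le_mul_of_nonneg_left (hswap a ha i hi) (hw0 i (Finset.mem_sdiff.1 hi).1)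
  have h3 : ∑ i ∈ S, (1 - w i) * r i ≤ ∑ i ∈ S, (1 - w i) * r a :=
    Finset.sum_le_sum fun i hi =>
      mul_le_mul_of_nonneg_left (hmax i hi) (sub_nonneg.2 (hw1 i (hSs hi)))
  have h4 : ∑ i ∈ S, (1 - w i) * r i = ∑ i ∈ S, r i - ∑ i ∈ S, w i * r i := by
    rw [← Finset.sum_sub_distrib]; exact Finset.sum_congr rfl fun i _ => by ring
  have h5 : ∑ i ∈ S, (1 - w i) * r a = (d - ∑ i ∈ S, w i) * r a := by
    rw [← Finset.sum_mul, Finset.sum_sub_distrib]; simp [hScard]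
  have h6 : ∑ i ∈ s, w i = ∑ i ∈ s \ S, w i + ∑ i ∈ S, w i := (Finset.sum_sdiff hSs).symm
  rw [← Finset.sum_mul] at h2
  nlinarith [hr a (hSs ha)]

/-! ### Edges of a binomial random graph -/

section

variable {V : Type*}

instance [Finite V] : MeasurableSingletonClass (SimpleGraph V) where
  measurableSet_singleton G := by
    have h := measurableSet_singleton (G.edgeSet)
    convert SimpleGraph.measurable_edgeSet h
    ext H
    simp

/-- The edge indicators of a binomial random graph have the product law. -/
theorem map_mem_edgeSet_binomialRandom [Finite V] (p : unitInterval) :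
    (SimpleGraph.binomialRandom V p).map (fun G e => e ∈ G.edgeSet) =
      Measure.infinitePi (fun e : Sym2 V =>
        unitInterval.toNNReal p • Measure.dirac (¬ e.IsDiag) +
          unitInterval.toNNReal (unitInterval.symm p) • Measure.dirac False) := by
  have hmeas : Measurable (fun (G : SimpleGraph V) (e : Sym2 V) => e ∈ G.edgeSet) := by fun_prop
  refine Measure.ext fun S hS => ?_
  rw [Measure.map_apply hmeas hS, SimpleGraph.binomialRandom_apply,
    Set.image_preimage_eq_inter_range]
  have h1 := SimpleGraph.binomialRandom_apply p (Set.univ : Set (SimpleGraph V))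
  rw [measure_univ, Set.image_univ] at h1
  refine measure_inter_conull ?_
  rw [prob_compl_eq_zero_iff]
  · exact h1.symm
  · exact (Set.toFinite _).measurableSet

theorem iIndepFun_mem_edgeSet [Finite V] (p : unitInterval) :
    iIndepFun (fun (e : Sym2 V) (G : SimpleGraph V) => e ∈ G.edgeSet)
      (SimpleGraph.binomialRandom V p) := by
  have hm : ∀ e : Sym2 V, Measurable fun G : SimpleGraph V => e ∈ G.edgeSet := fun e => by fun_prop
  rw [iIndepFun_iff_map_fun_eq_infinitePi_map hm, map_mem_edgeSet_binomialRandom]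
  congr with e : 1
  have h1 : (fun G : SimpleGraph V => e ∈ G.edgeSet) =
      (fun x : Sym2 V → Prop => x e) ∘ fun G e => e ∈ G.edgeSet := rfl
  rw [h1, ← Measure.map_map (by fun_prop) (by fun_prop), map_mem_edgeSet_binomialRandom,
    Measure.infinitePi_map_eval]

theorem binomialRandom_real_mem_edgeSet [Finite V] (p : unitInterval) {e : Sym2 V}
    (he : ¬ e.IsDiag) :
    (SimpleGraph.binomialRandom V p).real {G | e ∈ G.edgeSet} = p := by
  have hm : Measurable (fun (G : SimpleGraph V) (e : Sym2 V) => e ∈ G.edgeSet) := by fun_prop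
  have h1 : {G : SimpleGraph V | e ∈ G.edgeSet} = (fun G e => e ∈ G.edgeSet) ⁻¹'
      ((fun x : Sym2 V → Prop => x e) ⁻¹' {True}) := by
    ext G; simp
  rw [h1, ← map_measureReal_apply hm (measurable_pi_apply e (measurableSet_singleton _)),
    map_mem_edgeSet_binomialRandom,
    ← map_measureReal_apply (measurable_pi_apply e) (measurableSet_singleton _),
    Measure.infinitePi_map_eval]
  simp [he, measureReal_def]

/-- Exponential moment of the number of discordant pairs in a family of disjoint pairs of
independent events of probability `p`. -/
theorem integral_prod_discordant {Ω τ : Type*} [Fintype τ] [DecidableEq τ] [MeasurableSpace Ω]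
    {μ : Measure Ω} [IsProbabilityMeasure μ] (X : τ → Bool → Ω → Prop)
    (hX : ∀ t b, Measurable (X t b))
    (hind : iIndepFun (fun s : τ × Bool => X s.1 s.2) μ) {p : ℝ}
    (hp : ∀ t b, μ.real {ω | X t b ω} = p) (ρ : ℝ) :
    ∫ ω, ∏ t, (open Classical in if X t true ω ↔ X t false ω then 1 else ρ) ∂μ =
      (1 - 2 * p * (1 - p) * (1 - ρ)) ^ Fintype.card τ := by
  classical
  let c : (Bool → Bool) → ℝ := fun s => if s true = s false then 1 else ρ
  let φ : Bool → Prop → ℝ := fun b a => if a ↔ b then 1 else 0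
  have hφm : ∀ b, Measurable (φ b) := fun b => .of_discrete
  have h1 : ∀ ω t, (if X t true ω ↔ X t false ω then (1 : ℝ) else ρ) =
      ∑ s : Bool → Bool, c s * ∏ b, φ (s b) (X t b ω) := by
    intro ω t
    rw [← (Equiv.boolArrowEquivProd Bool).symm.sum_comp, Fintype.sum_prod_type]
    by_cases h1 : X t true ω <;> by_cases h2 : X t false ω <;>
      simp [c, φ, h1, h2, Equiv.boolArrowEquivProd]
  have h2 : ∀ ω, ∏ t, (if X t true ω ↔ X t false ω then (1 : ℝ) else ρ) =
      ∑ s : τ → Bool → Bool, (∏ t, c (s t)) * ∏ x : τ × Bool, φ (s x.1 x.2) (X x.1 x.2 ω) := by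
    intro ω
    simp_rw [h1]
    rw [Finset.prod_univ_sum, Fintype.piFinset_univ]
    refine Finset.sum_congr rfl fun s _ => ?_
    rw [Finset.prod_mul_distrib, Fintype.prod_prod_type]
  have hint : ∀ b t b', ∫ ω, φ b (X t b' ω) ∂μ = if b then p else 1 - p := by
    intro b t b'
    have hm : MeasurableSet {ω | X t b' ω} := measurableSet_setOfPred.2 (hX t b')
    cases b
    · have : ∀ ω, φ false (X t b' ω) = Set.indicator {ω | X t b' ω}ᶜ (fun _ => (1 : ℝ)) ω := by
        intro ω
        by_cases h : X t b' ω <;> simp [φ, h]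
      simp_rw [this]
      rw [integral_indicator_const _ hm.compl, probReal_compl_eq_one_sub hm, hp]
      simp
    · have : ∀ ω, φ true (X t b' ω) = Set.indicator {ω | X t b' ω} (fun _ => (1 : ℝ)) ω := by
        intro ω
        by_cases h : X t b' ω <;> simp [φ, h]
      simp_rw [this]
      rw [integral_indicator_const _ hm, hp]
      simp
  have hprod : ∀ s : τ → Bool → Bool, ∫ ω, ∏ x : τ × Bool, φ (s x.1 x.2) (X x.1 x.2 ω) ∂μ =
      ∏ x : τ × Bool, if s x.1 x.2 then p else 1 - p := by
    intro s
    rw [hind.integral_fun_prod_comp (f := fun x : τ × Bool => φ (s x.1 x.2))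
      (fun x => (hX _ _).aemeasurable) (fun x => (hφm _).aestronglyMeasurable)]
    exact Finset.prod_congr rfl fun x _ => hint _ _ _
  have hintg : ∀ s : τ → Bool → Bool,
      Integrable (fun ω => ∏ x : τ × Bool, φ (s x.1 x.2) (X x.1 x.2 ω)) μ := by
    intro s
    refine Integrable.of_bound (C := 1) ?_ (.of_forall fun ω => ?_)
    · exact (Finset.measurable_prod _ fun x _ =>
        (hφm (s x.1 x.2)).comp (hX x.1 x.2)).aestronglyMeasurable
    · rw [Real.norm_eq_abs, Finset.abs_prod]
      refine Finset.prod_le_one (fun _ _ => abs_nonneg _) fun x _ => ?_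
      simp only [φ]
      split_ifs <;> simp
  simp_rw [h2]
  rw [integral_finsetSum _ fun s _ => (hintg s).const_mul _]
  simp_rw [integral_const_mul, hprod, Fintype.prod_prod_type, ← Finset.prod_mul_distrib]
  have h3 := Finset.prod_univ_sum (fun _ : τ => (Finset.univ : Finset (Bool → Bool)))
    (fun _ s => c s * ∏ b, if s b then p else 1 - p)
  rw [Fintype.piFinset_univ] at h3
  rw [← h3, Finset.prod_const, Finset.card_univ]
  congr 1
  rw [← (Equiv.boolArrowEquivProd Bool).symm.sum_comp, Fintype.sum_prod_type]
  simp [c, Equiv.boolArrowEquivProd]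
  ring

/-! ### Relabelling edges -/

/-- The graph obtained from `G` by relabelling vertices, where the relabelling `s b` of one
endpoint may depend on the other endpoint `b`. -/
def SimpleGraph.twist (s : V → V → V) (G : SimpleGraph V) : SimpleGraph V where
  Adj a b := G.Adj (s b a) (s a b)
  symm := ⟨fun _ _ h => h.symm⟩
  loopless := ⟨fun _ h => G.irrefl h⟩

theorem SimpleGraph.twist_twist {s : V → V → V} (hs : ∀ a b, s (s a b) (s b a) = a)
    (G : SimpleGraph V) : (G.twist s).twist s = G := by
  ext a b
  simp only [SimpleGraph.twist, hs]

/-- An involutive relabelling of the edges preserves the law of a binomial random graph. -/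
theorem binomialRandom_real_singleton_twist [Finite V] (p : unitInterval) {s : V → V → V}
    (hs : ∀ a b, s (s a b) (s b a) = a) (G : SimpleGraph V) :
    (SimpleGraph.binomialRandom V p).real {G.twist s} =
      (SimpleGraph.binomialRandom V p).real {G} := by
  classical
  have := Fintype.ofFinite V
  have h : (G.twist s).edgeSet.ncard = G.edgeSet.ncard := by
    have key : ∀ H : SimpleGraph V, ∑ x : V × V, (if H.Adj x.1 x.2 then 1 else 0) =
        2 * H.edgeSet.ncard := by
      intro H
      rw [Fintype.sum_prod_type, ← SimpleGraph.coe_edgeFinset, Set.ncard_coe_finset,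
        ← H.sum_degrees_eq_twice_card_edges]
      refine Finset.sum_congr rfl fun v _ => ?_
      have := H.degree_eq_sum_if_adj (R := ℕ) v
      simpa using this.symm
    have h1 := key (G.twist s)
    have h2 := key G
    let σ : Equiv.Perm (V × V) := Function.Involutive.toPerm
      (fun x => (s x.2 x.1, s x.1 x.2)) fun x => by simp [hs]
    rw [← Equiv.sum_comp σ] at h2
    have h3 : ∑ x : V × V, (if (G.twist s).Adj x.1 x.2 then 1 else 0) =
      ∑ x : V × V, (if G.Adj (σ x).1 (σ x).2 then 1 else 0) := rfl
    omega
  rw [measureReal_def, measureReal_def, SimpleGraph.binomialRandom_singleton,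
    SimpleGraph.binomialRandom_singleton, h]

end

/-! ### Small singular values and pairs of coordinates -/

/-- A linear map with a small singular value of index `n - k` admits `card κ` coordinates `f` with
short, almost singular dual vectors `v`, and its compression to the complementary coordinates is
small on a large space of left vectors `W`. -/
theorem exists_dual_family_and_left_subspace {ι κ : Type*} [Fintype ι] [DecidableEq ι]
    [Fintype κ] [DecidableEq κ] (T : EuclideanSpace ℝ ι →ₗ[ℝ] EuclideanSpace ℝ ι) {k : ℕ}
    (hk : k ≤ Fintype.card ι) (hκ : Fintype.card κ ≤ k) {δ : ℝ}
    (hδ : T.singularValues (Fintype.card ι - k) ≤ δ) :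
    ∃ f : κ → ι, Function.Injective f ∧
      (∃ v : κ → EuclideanSpace ℝ ι, (∀ a b, v a (f b) = if a = b then 1 else 0) ∧
        (∀ a, ‖T (v a)‖ ≤ δ * ‖v a‖) ∧
        ∀ a, ‖v a‖ ^ 2 * ((k : ℝ) - Fintype.card κ) ≤ Fintype.card ι) ∧
      ∃ W : Submodule ℝ (EuclideanSpace ℝ ι), k ≤ finrank ℝ W + Fintype.card κ ∧
        (∀ w ∈ W, ∀ a, w (f a) = 0) ∧
        ∀ w ∈ W, ∀ u : EuclideanSpace ℝ ι, (∀ a, u (f a) = 0) →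
          |inner ℝ w (T u)| ≤ δ * ‖w‖ * ‖u‖ := by
  have hδ0 : 0 ≤ δ := (T.singularValues_nonneg _).trans hδ
  obtain ⟨V, hVk, hV⟩ := exists_submodule_norm_apply_le T finrank_euclideanSpace hk hδ
  obtain ⟨f, hf, v, hvV, hvf, hvn⟩ := exists_dual_family (κ := κ) V (by rwa [hVk])
  refine ⟨f, hf, ⟨v, hvf, fun a => hV _ (hvV a), fun a => by rw [← hVk]; exact hvn a⟩, ?_⟩
  let R : EuclideanSpace ℝ ι →ₗ[ℝ] (κ → ℝ) :=
    LinearMap.pi fun a => (EuclideanSpace.proj (f a) : EuclideanSpace ℝ ι →L[ℝ] ℝ).toLinearMap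
  have hR : ∀ x, x ∈ LinearMap.ker R ↔ ∀ a, x (f a) = 0 := by
    intro x
    rw [LinearMap.mem_ker, funext_iff]
    rfl
  set U := LinearMap.ker R with hU
  let T' : U →ₗ[ℝ] U := U.orthogonalProjectionOnto.toLinearMap ∘ₗ T ∘ₗ U.subtype
  have hT' : ∀ u : U, ‖T' u‖ ≤ ‖T u‖ := fun u => U.norm_starProjection_apply_le (T u)
  obtain ⟨W, hW1, hW2⟩ := exists_submodule_inner_apply_le T' hδ0 (V.comap U.subtype)
    fun x hx => (hT' x).trans (hV _ hx)
  have hdim : k ≤ finrank ℝ (V.comap U.subtype) + Fintype.card κ := by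
    have h1 := (R.domRestrict V).finrank_range_add_finrank_ker
    have h2 : finrank ℝ (LinearMap.range (R.domRestrict V)) ≤ Fintype.card κ := by
      simpa using Submodule.finrank_le (LinearMap.range (R.domRestrict V))
    have h3 : finrank ℝ (LinearMap.ker (R.domRestrict V)) ≤ finrank ℝ (V.comap U.subtype) := by
      let g : LinearMap.ker (R.domRestrict V) →ₗ[ℝ] V.comap U.subtype :=
        { toFun := fun x => ⟨⟨x.1.1, x.2⟩, x.1.2⟩
          map_add' := fun _ _ => rfl
          map_smul' := fun _ _ => rfl }
      refine LinearMap.finrank_le_finrank_of_injective (f := g) fun x y h => ?_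
      have : x.1.1 = y.1.1 := congrArg (fun z => z.1.1) h
      exact Subtype.ext (Subtype.ext this)
    omega
  refine ⟨W.map U.subtype, ?_, ?_, ?_⟩
  · rw [Submodule.finrank_map_subtype_eq]
    omega
  · rintro _ ⟨w, -, rfl⟩
    exact (hR _).1 w.2
  · rintro _ ⟨w, hw, rfl⟩ u hu
    have h1 := hW2 w hw ⟨u, (hR u).2 hu⟩
    have h2 : inner ℝ w (T' ⟨u, (hR u).2 hu⟩) = inner ℝ (w : EuclideanSpace ℝ ι) (T u) := by
      change inner ℝ (w : EuclideanSpace ℝ ι) (U.starProjection (T u)) = _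
      rw [← Submodule.inner_starProjection_left_eq_right,
        Submodule.starProjection_eq_self_iff.2 w.2]
    rw [h2] at h1
    exact h1

/-- Upper bound for the projections of the selected columns onto the left space `W`: testing
`T (v a)` against `W`, only the column `f a` and the compressed part of `T` contribute. -/
theorem norm_starProjection_apply_single_le {ι κ : Type*} [Fintype ι] [DecidableEq ι]
    [DecidableEq κ] (T : EuclideanSpace ℝ ι →ₗ[ℝ] EuclideanSpace ℝ ι) {f : κ → ι}
    {δ β : ℝ} (hδ : 0 ≤ δ) {v : κ → EuclideanSpace ℝ ι}
    (hvf : ∀ a b, v a (f b) = if a = b then 1 else 0) (hTv : ∀ a, ‖T (v a)‖ ≤ δ * ‖v a‖)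
    (hvβ : ∀ a, ‖v a‖ ≤ β) (hf : Function.Injective f) {W : Submodule ℝ (EuclideanSpace ℝ ι)}
    (hW : ∀ w ∈ W, ∀ u : EuclideanSpace ℝ ι, (∀ a, u (f a) = 0) →
      |inner ℝ w (T u)| ≤ δ * ‖w‖ * ‖u‖) (a : κ) :
    ‖W.starProjection (T (EuclideanSpace.single (f a) 1))‖ ≤ 2 * δ * β := by
  set e := EuclideanSpace.single (f a) (1 : ℝ) with he
  set w := W.starProjection (T e) with hw
  have hwW : w ∈ W := W.starProjection_apply_mem _
  have hu0 : ∀ b, (v a - e) (f b) = 0 := by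
    intro b
    rw [PiLp.sub_apply, hvf, he, PiLp.single_apply]
    by_cases h : a = b
    · simp [h]
    · rw [if_neg h, if_neg fun h' => h (hf h').symm, sub_zero]
  have hun : ‖v a - e‖ ≤ ‖v a‖ := by
    refine abs_le_of_sq_le_sq' ?_ (norm_nonneg _) |>.2
    rw [EuclideanSpace.real_norm_sq_eq, EuclideanSpace.real_norm_sq_eq]
    refine Finset.sum_le_sum fun i _ => ?_
    rw [PiLp.sub_apply, he, PiLp.single_apply]
    split_ifs with h
    · rw [h, hvf]; simp
    · simp
  have h1 : ‖w‖ ^ 2 = inner ℝ w (T (v a)) - inner ℝ w (T (v a - e)) := by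
    rw [← inner_sub_right, ← map_sub, sub_sub_cancel, ← real_inner_self_eq_norm_sq]
    conv_lhs => rw [hw, Submodule.inner_starProjection_left_eq_right, ← hw,
      Submodule.starProjection_eq_self_iff.2 hwW]
    exact real_inner_comm _ _
  have h2 : inner ℝ w (T (v a)) ≤ ‖w‖ * (δ * ‖v a‖) :=
    (real_inner_le_norm _ _).trans (by gcongr; exact hTv a)
  have h3 : -inner ℝ w (T (v a - e)) ≤ ‖w‖ * (δ * ‖v a‖) := by
    refine (neg_le_abs _).trans ((hW w hwW _ hu0).trans ?_)
    calc δ * ‖w‖ * ‖v a - e‖ ≤ δ * ‖w‖ * ‖v a‖ := by gcongr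
      _ = _ := by ring
  have h4 : ‖w‖ * ‖w‖ ≤ ‖w‖ * (2 * δ * ‖v a‖) := by nlinarith
  have hβ : 2 * δ * ‖v a‖ ≤ 2 * δ * β := by gcongr; exact hvβ a
  rcases (norm_nonneg w).eq_or_lt with h | h
  · rw [← h]
    exact (by positivity : 0 ≤ 2 * δ * ‖v a‖).trans hβ
  · exact (le_of_mul_le_mul_left h4 h).trans hβ

/-! ### Swapping edges within pairs -/

section

variable {V : Type*} {q : ℕ}

open Classical in
/-- Relabelling of the vertices `f (l, b)` as seen from the vertex `j`: when `j` is not one of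
these vertices, the two members of the pair `l` are exchanged if `η l j` holds. Every other vertex
is fixed. -/
noncomputable def swapPairs (f : Fin q × Bool → V) (η : Fin q → V → Bool) (j a : V) : V :=
  if h : (∃ x, f x = a) ∧ j ∉ Set.range f then
    f (h.1.choose.1, xor h.1.choose.2 (η h.1.choose.1 j)) else a

variable {f : Fin q × Bool → V} (η : Fin q → V → Bool)

theorem swapPairs_of_mem {j : V} (hj : j ∈ Set.range f) (a : V) : swapPairs f η j a = a :=
  dif_neg fun h => h.2 hj

theorem swapPairs_of_notMem (j : V) {a : V} (ha : a ∉ Set.range f) : swapPairs f η j a = a :=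
  dif_neg fun h => ha h.1

theorem swapPairs_apply (hf : Function.Injective f) {j : V} (hj : j ∉ Set.range f)
    (x : Fin q × Bool) : swapPairs f η j (f x) = f (x.1, xor x.2 (η x.1 j)) := by
  have h : (∃ y, f y = f x) ∧ j ∉ Set.range f := ⟨⟨x, rfl⟩, hj⟩
  have hx : h.1.choose = x := hf h.1.choose_spec
  rw [swapPairs, dif_pos h, hx]

theorem swapPairs_involutive (hf : Function.Injective f) (j : V) :
    Function.Involutive (swapPairs f η j) := by
  intro a
  by_cases hj : j ∈ Set.range f
  · simp only [swapPairs_of_mem η hj]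
  by_cases ha : a ∈ Set.range f
  · obtain ⟨x, rfl⟩ := ha
    rw [swapPairs_apply η hf hj, swapPairs_apply η hf hj]
    simp
  · simp only [swapPairs_of_notMem η j ha]

theorem swapPairs_mem_range (hf : Function.Injective f) (j : V) {a : V} (ha : a ∈ Set.range f) :
    swapPairs f η j a ∈ Set.range f := by
  by_cases hj : j ∈ Set.range f
  · rwa [swapPairs_of_mem η hj]
  · obtain ⟨x, rfl⟩ := ha
    rw [swapPairs_apply η hf hj]
    exact ⟨_, rfl⟩

theorem swapPairs_swapPairs (hf : Function.Injective f) (a b : V) :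
    swapPairs f η (swapPairs f η a b) (swapPairs f η b a) = a := by
  by_cases hb : b ∈ Set.range f
  · rw [swapPairs_of_mem η (swapPairs_mem_range η hf a hb), swapPairs_of_mem η hb]
  · rw [swapPairs_of_notMem η a hb, swapPairs_involutive η hf]

theorem twist_swapPairs_adj (hf : Function.Injective f) (G : SimpleGraph V) {j : V}
    (hj : j ∉ Set.range f) (x : Fin q × Bool) :
    (G.twist (swapPairs f η)).Adj j (f x) ↔ G.Adj j (f (x.1, xor x.2 (η x.1 j))) := by
  simp only [SimpleGraph.twist]
  rw [swapPairs_of_notMem η _ hj, swapPairs_apply η hf hj]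

end

section

variable {n : ℕ}

open Classical in
/-- The `(i, j)` entry of the adjacency matrix of `G`, as a real number. -/
noncomputable def adjIndicator {V : Type*} (G : SimpleGraph V) (i j : V) : ℝ :=
  if G.Adj i j then 1 else 0

theorem adjIndicator_congr {V : Type*} {G H : SimpleGraph V} {i j k l : V}
    (h : G.Adj i j ↔ H.Adj k l) : adjIndicator G i j = adjIndicator H k l := by
  unfold adjIndicator
  by_cases h' : G.Adj i j
  · rw [if_pos h', if_pos (h.1 h')]
  · rw [if_neg h', if_neg (mt h.2 h')]

theorem graphLaplacian_apply_of_ne (G : SimpleGraph (Fin n)) {i j : Fin n} (h : i ≠ j) :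
    graphLaplacian G i j = -adjIndicator G i j := by
  unfold graphLaplacian adjIndicator
  simp [SimpleGraph.lapMatrix, SimpleGraph.degMatrix, Matrix.diagonal_apply_ne _ h,
    SimpleGraph.adjMatrix_apply]

theorem graphLaplacian_apply_self (G : SimpleGraph (Fin n)) (i : Fin n) :
    graphLaplacian G i i = ∑ j, adjIndicator G i j := by
  let _ : DecidableRel G.Adj := Classical.decRel G.Adj
  have h : graphLaplacian G i i = (G.degree i : ℝ) := by
    unfold graphLaplacian
    simp [SimpleGraph.lapMatrix, SimpleGraph.degMatrix, SimpleGraph.adjMatrix_apply]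
  rw [h, G.degree_eq_sum_if_adj]
  exact Finset.sum_congr rfl fun j _ => by unfold adjIndicator; congr

/-- Swapping edges within pairs does not change the Laplacian away from the paired vertices: the
degree of a vertex `i` outside the pairs stays the same. -/
theorem graphLaplacian_twist_swapPairs {q : ℕ} {f : Fin q × Bool → Fin n}
    (hf : Function.Injective f) (η : Fin q → Fin n → Bool) (G : SimpleGraph (Fin n))
    {i j : Fin n} (hi : i ∉ Set.range f) (hj : j ∉ Set.range f) :
    graphLaplacian (G.twist (swapPairs f η)) i j = graphLaplacian G i j := by
  have hadj : ∀ b, (G.twist (swapPairs f η)).Adj i b ↔ G.Adj i (swapPairs f η i b) := by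
    intro b
    simp only [SimpleGraph.twist]
    rw [swapPairs_of_notMem η b hi]
  by_cases hij : i = j
  · subst hij
    rw [graphLaplacian_apply_self, graphLaplacian_apply_self,
      ← Equiv.sum_comp (Function.Involutive.toPerm _ (swapPairs_involutive η hf i))
        (fun j => adjIndicator G i j)]
    exact Finset.sum_congr rfl fun b _ => adjIndicator_congr (hadj b)
  · rw [graphLaplacian_apply_of_ne _ hij, graphLaplacian_apply_of_ne _ hij]
    rw [adjIndicator_congr (hadj j), swapPairs_of_notMem η _ hj]

end

/-! ### Probability of degeneracy at given pairs -/

/-- `T` is degenerate at the coordinates `f`, with parameters `δ`, `β` and `d`, if there are dual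
vectors `v` of norm at most `β` for these coordinates which `T` contracts by the factor `δ`, and if
the compression of `T` to the other coordinates has a space of left vectors, of dimension at least
`d`, on which it is bounded by `δ`. -/
def IsDegenerateAt {ι κ : Type*} [Fintype ι] [DecidableEq κ]
    (T : EuclideanSpace ℝ ι →ₗ[ℝ] EuclideanSpace ℝ ι) (f : κ → ι) (δ β : ℝ) (d : ℕ) : Prop :=
  (∃ v : κ → EuclideanSpace ℝ ι, (∀ a b, v a (f b) = if a = b then 1 else 0) ∧
    (∀ a, ‖T (v a)‖ ≤ δ * ‖v a‖) ∧ ∀ a, ‖v a‖ ≤ β) ∧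
  ∃ W : Submodule ℝ (EuclideanSpace ℝ ι), d ≤ finrank ℝ W ∧ (∀ w ∈ W, ∀ a, w (f a) = 0) ∧
    ∀ w ∈ W, ∀ u : EuclideanSpace ℝ ι, (∀ a, u (f a) = 0) →
      |inner ℝ w (T u)| ≤ δ * ‖w‖ * ‖u‖

section

variable {n : ℕ}

theorem inner_toEuclideanLin (M : Matrix (Fin n) (Fin n) ℝ) (w u : EuclideanSpace ℝ (Fin n)) :
    inner ℝ w (Matrix.toEuclideanLin M u) = ∑ i, ∑ j, w i * M i j * u j := by
  rw [PiLp.inner_apply]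
  refine Finset.sum_congr rfl fun i _ => ?_
  simp [Matrix.toEuclideanLin, Matrix.toLpLin_apply, Matrix.mulVec, dotProduct, Finset.sum_mul]
  exact Finset.sum_congr rfl fun j _ => by ring

/-- The form of a matrix on vectors vanishing on a set of coordinates only involves the entries
outside that set. -/
theorem inner_toEuclideanLin_congr {κ : Type*} {f : κ → Fin n} {M N : Matrix (Fin n) (Fin n) ℝ}
    (h : ∀ i j, i ∉ Set.range f → j ∉ Set.range f → M i j = N i j)
    {w u : EuclideanSpace ℝ (Fin n)} (hw : ∀ a, w (f a) = 0) (hu : ∀ a, u (f a) = 0) :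
    inner ℝ w (Matrix.toEuclideanLin M u) = inner ℝ w (Matrix.toEuclideanLin N u) := by
  rw [inner_toEuclideanLin, inner_toEuclideanLin]
  refine Finset.sum_congr rfl fun i _ => Finset.sum_congr rfl fun j _ => ?_
  by_cases hi : i ∈ Set.range f
  · obtain ⟨a, rfl⟩ := hi
    rw [hw]; ring
  by_cases hj : j ∈ Set.range f
  · obtain ⟨a, rfl⟩ := hj
    rw [hu]; ring
  rw [h i j hi hj]

theorem starProjection_toEuclideanLin_single (M : Matrix (Fin n) (Fin n) ℝ)
    (W : Submodule ℝ (EuclideanSpace ℝ (Fin n))) (i : Fin n) :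
    W.starProjection (Matrix.toEuclideanLin M (EuclideanSpace.single i 1)) =
      ∑ j, M j i • W.starProjection (EuclideanSpace.single j 1) := by
  have h : Matrix.toEuclideanLin M (EuclideanSpace.single i 1) =
      ∑ j, M j i • EuclideanSpace.single j (1 : ℝ) := by
    ext k
    simp [Matrix.toEuclideanLin, Matrix.toLpLin_apply, Finset.sum_apply, Pi.single_apply]
  rw [h, map_sum]
  simp_rw [map_smul]

/-- If the vectors of `W` vanish at the coordinate `i`, then `W` is orthogonal to the unit vector
of that coordinate. -/
theorem starProjection_single_eq_zero {W : Submodule ℝ (EuclideanSpace ℝ (Fin n))} {i : Fin n}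
    (h : ∀ w ∈ W, w i = 0) : W.starProjection (EuclideanSpace.single i 1) = 0 := by
  rw [Submodule.starProjection_apply_eq_zero_iff, Submodule.mem_orthogonal]
  intro w hw
  rw [real_inner_comm, EuclideanSpace.inner_single_left, h w hw, mul_zero]

/-- After swapping edges within pairs, the difference of the projections of two paired columns is
a signed sum, whose signs are given by the swaps, up to a fixed vector. -/
theorem starProjection_pair_eq {q : ℕ} {f : Fin q × Bool → Fin n} (hf : Function.Injective f)
    (η : Fin q → Fin n → Bool) (G : SimpleGraph (Fin n)) (F : Matrix (Fin n) (Fin n) ℝ)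
    {W : Submodule ℝ (EuclideanSpace ℝ (Fin n))} (hW : ∀ w ∈ W, ∀ a, w (f a) = 0) (l : Fin q) :
    W.starProjection (Matrix.toEuclideanLin (graphLaplacian (G.twist (swapPairs f η)) + F)
        (EuclideanSpace.single (f (l, true)) 1)) -
      W.starProjection (Matrix.toEuclideanLin (graphLaplacian (G.twist (swapPairs f η)) + F)
        (EuclideanSpace.single (f (l, false)) 1)) =
    ∑ j, (F j (f (l, true)) - F j (f (l, false))) • W.starProjection (EuclideanSpace.single j 1) -
      ∑ j, (if η l j then (1 : ℝ) else -1) •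
        ((adjIndicator G j (f (l, false)) - adjIndicator G j (f (l, true))) •
          W.starProjection (EuclideanSpace.single j 1)) := by
  rw [starProjection_toEuclideanLin_single, starProjection_toEuclideanLin_single,
    ← Finset.sum_sub_distrib, ← Finset.sum_sub_distrib]
  refine Finset.sum_congr rfl fun j _ => ?_
  by_cases hj : j ∈ Set.range f
  · obtain ⟨a, rfl⟩ := hj
    rw [starProjection_single_eq_zero fun w hw => hW w hw a]
    simp
  · have hne : ∀ x, j ≠ f x := fun x h => hj ⟨x, h.symm⟩
    rw [← sub_smul, smul_smul, ← sub_smul, Matrix.add_apply, Matrix.add_apply,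
      graphLaplacian_apply_of_ne _ (hne _), graphLaplacian_apply_of_ne _ (hne _),
      adjIndicator_congr (twist_swapPairs_adj η hf G hj (l, true)),
      adjIndicator_congr (twist_swapPairs_adj η hf G hj (l, false))]
    congr 1
    cases η l j <;> simp <;> ring

/-- Number of ways to swap edges within pairs that make the perturbed Laplacian degenerate. The
bound is in terms of the discordances of the pairs, seen from the vertices of a `d`-element set. -/
theorem card_isDegenerateAt_twist_le {q d : ℕ} {f : Fin q × Bool → Fin n}
    (hf : Function.Injective f) (G : SimpleGraph (Fin n)) (F : Matrix (Fin n) (Fin n) ℝ)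
    {δ β : ℝ} (hδ : 0 ≤ δ) (s : Finset (Fin n)) (hs : ∀ j, j ∈ s ↔ j ∉ Set.range f) :
    (Nat.card {η : Fin q → Fin n → Bool // IsDegenerateAt (Matrix.toEuclideanLin
        (graphLaplacian (G.twist (swapPairs f η)) + F)) f δ β d} : ℝ) ≤
      Real.exp (8 * q * (δ * β) ^ 2) * (2 ^ (n * q) * ∑ S ∈ s.powersetCard d,
        Real.exp (-((∑ j ∈ S, ∑ l, (adjIndicator G j (f (l, false)) -
          adjIndicator G j (f (l, true))) ^ 2) / 4))) := by
  classical
  by_cases hex : ∃ η₀ : Fin q → Fin n → Bool, IsDegenerateAt (Matrix.toEuclideanLin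
      (graphLaplacian (G.twist (swapPairs f η₀)) + F)) f δ β d
  swap
  · push Not at hex
    have : IsEmpty {η : Fin q → Fin n → Bool // IsDegenerateAt (Matrix.toEuclideanLin
        (graphLaplacian (G.twist (swapPairs f η)) + F)) f δ β d} := ⟨fun η => hex η.1 η.2⟩
    rw [Nat.card_of_isEmpty, Nat.cast_zero]
    positivity
  obtain ⟨η₀, -, W, hWd, hW0, hW⟩ := hex
  -- The left space `W` depends only on the part of the Laplacian that the swaps preserve.
  have hWη : ∀ (η : Fin q → Fin n → Bool), ∀ w ∈ W, ∀ u : EuclideanSpace ℝ (Fin n),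
      (∀ a, u (f a) = 0) → |inner ℝ w (Matrix.toEuclideanLin
        (graphLaplacian (G.twist (swapPairs f η)) + F) u)| ≤ δ * ‖w‖ * ‖u‖ := by
    intro η w hw u hu
    rw [inner_toEuclideanLin_congr (f := f) (N := graphLaplacian (G.twist (swapPairs f η₀)) + F)
      _ (hW0 w hw) hu]
    · exact hW w hw u hu
    · intro i j hi hj
      rw [Matrix.add_apply, Matrix.add_apply, graphLaplacian_twist_swapPairs hf η G hi hj,
        graphLaplacian_twist_swapPairs hf η₀ G hi hj]
  set e : Fin n → EuclideanSpace ℝ (Fin n) :=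
    fun j => W.starProjection (EuclideanSpace.single j 1) with he
  set x : Fin q → EuclideanSpace ℝ (Fin n) :=
    fun l => ∑ j, (F j (f (l, true)) - F j (f (l, false))) • e j with hx
  set D : Fin q → Fin n → ℝ :=
    fun l j => adjIndicator G j (f (l, false)) - adjIndicator G j (f (l, true)) with hD
  have hD1 : ∀ l j, D l j ^ 2 ≤ 1 := by
    intro l j
    simp only [hD, adjIndicator]
    split_ifs <;> norm_num
  have hsmall : ∀ η : Fin q → Fin n → Bool, IsDegenerateAt (Matrix.toEuclideanLin
      (graphLaplacian (G.twist (swapPairs f η)) + F)) f δ β d → ∀ l,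
      ‖x l - ∑ j, (if η l j then (1 : ℝ) else -1) • (D l j • e j)‖ ^ 2 ≤ 16 * (δ * β) ^ 2 := by
    rintro η ⟨⟨v, hvf, hTv, hvβ⟩, -⟩ l
    have h1 := fun a => norm_starProjection_apply_single_le _ hδ hvf hTv hvβ hf (hWη η) a
    rw [← starProjection_pair_eq hf η G F hW0 l]
    have h2 := (norm_sub_le (W.starProjection (Matrix.toEuclideanLin
        (graphLaplacian (G.twist (swapPairs f η)) + F) (EuclideanSpace.single (f (l, true)) 1)))
      (W.starProjection (Matrix.toEuclideanLin (graphLaplacian (G.twist (swapPairs f η)) + F)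
        (EuclideanSpace.single (f (l, false)) 1)))).trans (add_le_add (h1 _) (h1 _))
    calc _ ≤ (2 * δ * β + 2 * δ * β) ^ 2 := by gcongr
      _ = _ := by ring
  have hball : ∀ l, ∑ ε : Fin n → Bool,
      Real.exp (-(‖x l - ∑ j, (if ε j then (1 : ℝ) else -1) • (D l j • e j)‖ ^ 2 / 2)) ≤
      2 ^ n * Real.exp (-((∑ j, D l j ^ 2 * ‖e j‖ ^ 2) / 4)) := by
    intro l
    have h1 := sum_exp_neg_norm_sub_sum_sign_le (fun j => D l j • e j) ?_ (x l)
    · simpa [norm_smul, mul_pow] using h1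
    · intro c
      have h2 : ∑ j, c j • D l j • e j =
          W.starProjection (∑ j, (c j * D l j) • EuclideanSpace.single j 1) := by
        rw [map_sum]
        simp_rw [map_smul, smul_smul, he]
      have h3 : ‖∑ j, (c j * D l j) • EuclideanSpace.single j (1 : ℝ)‖ ^ 2 =
          ∑ j, (c j * D l j) ^ 2 := by
        rw [EuclideanSpace.real_norm_sq_eq]
        refine Finset.sum_congr rfl fun i _ => ?_
        simp [Finset.sum_apply, Pi.single_apply]
      rw [h2]
      refine (pow_le_pow_left₀ (norm_nonneg _) (W.norm_starProjection_apply_le _) 2).trans ?_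
      rw [h3]
      refine Finset.sum_le_sum fun j _ => ?_
      rw [mul_pow]
      exact mul_le_of_le_one_right (sq_nonneg _) (hD1 l j)
  have hextreme : ∃ S ∈ s.powersetCard d, ∑ j ∈ S, ∑ l, D l j ^ 2 ≤
      ∑ l, ∑ j, D l j ^ 2 * ‖e j‖ ^ 2 := by
    have hout : ∀ g : Fin n → ℝ, ∑ j ∈ s, ‖e j‖ ^ 2 * g j = ∑ j, ‖e j‖ ^ 2 * g j := by
      intro g
      refine Finset.sum_subset (Finset.subset_univ _) fun j _ hj => ?_
      rw [hs, not_not] at hj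
      obtain ⟨a, rfl⟩ := hj
      simp only [he]
      rw [starProjection_single_eq_zero fun w hw => hW0 w hw a]
      simp
    have h1 : (d : ℝ) ≤ ∑ j ∈ s, ‖e j‖ ^ 2 := by
      have h2 := hout fun _ => 1
      simp only [mul_one] at h2
      rw [h2, sum_norm_sq_starProjection_single]
      exact_mod_cast hWd
    obtain ⟨S, hS, hS2⟩ := exists_subset_sum_le_sum_mul s (fun j => ∑ l, D l j ^ 2)
      (fun j => ‖e j‖ ^ 2) (fun j _ => Finset.sum_nonneg fun l _ => sq_nonneg _)
      (fun j _ => sq_nonneg _) (fun j _ => by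
        have := W.norm_starProjection_apply_le (EuclideanSpace.single j (1 : ℝ))
        rw [PiLp.norm_single, norm_one] at this
        exact pow_le_one₀ (norm_nonneg _) this) h1
    refine ⟨S, hS, hS2.trans_eq ?_⟩
    rw [hout, Finset.sum_comm]
    refine Finset.sum_congr rfl fun j _ => ?_
    rw [Finset.mul_sum]
    exact Finset.sum_congr rfl fun l _ => mul_comm _ _
  obtain ⟨S, hS, hSle⟩ := hextreme
  have hprod : ∑ η : Fin q → Fin n → Bool, ∏ l, Real.exp (-(‖x l - ∑ j,
      (if η l j then (1 : ℝ) else -1) • (D l j • e j)‖ ^ 2 / 2)) ≤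
      2 ^ (n * q) * Real.exp (-((∑ j ∈ S, ∑ l, D l j ^ 2) / 4)) := by
    have h1 := Finset.prod_univ_sum (fun _ : Fin q => (Finset.univ : Finset (Fin n → Bool)))
      (fun l ε => Real.exp (-(‖x l - ∑ j, (if ε j then (1 : ℝ) else -1) • (D l j • e j)‖ ^ 2 / 2)))
    rw [Fintype.piFinset_univ] at h1
    rw [← h1]
    refine (Finset.prod_le_prod (fun l _ => by positivity) fun l _ => hball l).trans ?_
    rw [Finset.prod_mul_distrib, Finset.prod_const, Finset.card_univ, Fintype.card_fin, ← pow_mul,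
      ← Real.exp_sum, Finset.sum_neg_distrib, ← Finset.sum_div]
    gcongr
  have hcount : (Nat.card {η : Fin q → Fin n → Bool // IsDegenerateAt (Matrix.toEuclideanLin
        (graphLaplacian (G.twist (swapPairs f η)) + F)) f δ β d} : ℝ) ≤
      Real.exp (8 * q * (δ * β) ^ 2) * ∑ η : Fin q → Fin n → Bool, ∏ l, Real.exp (-(‖x l - ∑ j,
      (if η l j then (1 : ℝ) else -1) • (D l j • e j)‖ ^ 2 / 2)) := by
    rw [Nat.card_eq_fintype_card, Fintype.card_subtype, Finset.card_filter, Nat.cast_sum,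
      Finset.mul_sum]
    refine Finset.sum_le_sum fun η _ => ?_
    split_ifs with hη
    · rw [← Real.exp_sum, ← Real.exp_add, Nat.cast_one, Real.one_le_exp_iff,
        Finset.sum_neg_distrib]
      have h1 : ∑ l : Fin q, ‖x l - ∑ j, (if η l j then (1 : ℝ) else -1) • (D l j • e j)‖ ^ 2 / 2 ≤
          ∑ l : Fin q, 16 * (δ * β) ^ 2 / 2 :=
        Finset.sum_le_sum fun l _ => by
          have := hsmall η hη l
          linarith
      rw [Finset.sum_const, Finset.card_univ, Fintype.card_fin, nsmul_eq_mul] at h1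
      linarith
    · rw [Nat.cast_zero]
      positivity
  refine hcount.trans ?_
  gcongr
  refine hprod.trans ?_
  gcongr
  exact Finset.single_le_sum (f := fun S => Real.exp (-((∑ j ∈ S, ∑ l, D l j ^ 2) / 4)))
    (fun _ _ => (Real.exp_pos _).le) hS

end

/-- Exponential moment of the number of discordant pairs seen from a set `S` of vertices. -/
theorem integral_exp_neg_discordance {n q : ℕ} {f : Fin q × Bool → Fin n}
    (hf : Function.Injective f) (p : unitInterval) (S : Finset (Fin n))
    (hS : ∀ j ∈ S, j ∉ Set.range f) :
    ∫ G, Real.exp (-((∑ j ∈ S, ∑ l, (adjIndicator G j (f (l, false)) -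
        adjIndicator G j (f (l, true))) ^ 2) / 4)) ∂(SimpleGraph.binomialRandom (Fin n) p) =
      (1 - 2 * p * (1 - p) * (1 - Real.exp (-(1 / 4)))) ^ (S.card * q) := by
  classical
  let X : S × Fin q → Bool → SimpleGraph (Fin n) → Prop :=
    fun t b G => s(t.1.1, f (t.2, b)) ∈ G.edgeSet
  have hne : ∀ (t : S × Fin q) b, (t.1 : Fin n) ≠ f (t.2, b) := fun t b h =>
    hS t.1 t.1.2 ⟨_, h.symm⟩
  have hinj : Function.Injective fun x : (S × Fin q) × Bool =>
      s((x.1.1 : Fin n), f (x.1.2, x.2)) := by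
    rintro ⟨t, b⟩ ⟨t', b'⟩ h
    rcases Sym2.eq_iff.1 h with ⟨h1, h2⟩ | ⟨h1, h2⟩
    · have h3 := hf h2
      simp only [Prod.mk.injEq] at h3
      exact Prod.ext (Prod.ext (Subtype.ext h1) h3.1) h3.2
    · exact absurd ⟨_, h1.symm⟩ (hS t.1 t.1.2)
  have key := integral_prod_discordant (μ := SimpleGraph.binomialRandom (Fin n) p) X
    (fun t b => by fun_prop) ((iIndepFun_mem_edgeSet p).precomp hinj)
    (fun t b => binomialRandom_real_mem_edgeSet p (by simpa using hne t b)) (Real.exp (-(1 / 4)))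
  rw [Fintype.card_prod, Fintype.card_coe, Fintype.card_fin] at key
  rw [← key]
  congr 1
  ext G
  rw [Fintype.prod_prod_type, ← Finset.sum_coe_sort, Finset.sum_div, ← Finset.sum_neg_distrib,
    Real.exp_sum]
  refine Finset.prod_congr rfl fun j _ => ?_
  rw [Finset.sum_div, ← Finset.sum_neg_distrib, Real.exp_sum]
  refine Finset.prod_congr rfl fun l _ => ?_
  simp only [X, SimpleGraph.mem_edgeSet, adjIndicator]
  by_cases h1 : G.Adj j (f (l, true)) <;> by_cases h2 : G.Adj j (f (l, false)) <;> simp [h1, h2]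

/-- Degeneracy at given pairs has probability exponentially small in `d * q`, up to the number of
`d`-element sets of vertices. -/
theorem binomialRandom_real_isDegenerateAt_le {n q d : ℕ} {f : Fin q × Bool → Fin n}
    (hf : Function.Injective f) (p : unitInterval) (F : Matrix (Fin n) (Fin n) ℝ) {δ β : ℝ}
    (hδ : 0 ≤ δ) :
    (SimpleGraph.binomialRandom (Fin n) p).real
        {G | IsDegenerateAt (Matrix.toEuclideanLin (graphLaplacian G + F)) f δ β d} ≤
      Real.exp (8 * q * (δ * β) ^ 2) * (n ^ d *
        (1 - 2 * p * (1 - p) * (1 - Real.exp (-(1 / 4)))) ^ (d * q)) := by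
  classical
  have := Fintype.ofFinite (SimpleGraph (Fin n))
  set μ := SimpleGraph.binomialRandom (Fin n) p with hμ
  set A := {G | IsDegenerateAt (Matrix.toEuclideanLin (graphLaplacian G + F)) f δ β d} with hA
  set κ : ℝ := 1 - 2 * p * (1 - p) * (1 - Real.exp (-(1 / 4))) with hκ
  have hκ0 : 0 ≤ κ := by
    have h0 : (0 : ℝ) ≤ p := p.2.1
    have h1 : (p : ℝ) ≤ 1 := p.2.2
    have h2 : 2 * (p : ℝ) * (1 - p) ≤ 1 := by nlinarith [sq_nonneg ((p : ℝ) - 1 / 2)]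
    have h3 : 0 ≤ 2 * (p : ℝ) * (1 - p) := by
      have := sub_nonneg.2 h1
      positivity
    have h4 := Real.exp_pos (-(1 / 4))
    have h5 : 2 * (p : ℝ) * (1 - p) * (1 - Real.exp (-(1 / 4))) ≤ 2 * (p : ℝ) * (1 - p) :=
      mul_le_of_le_one_right h3 (by linarith)
    linarith
  let s : Finset (Fin n) := Finset.univ.filter fun j => j ∉ Set.range f
  have hs : ∀ j, j ∈ s ↔ j ∉ Set.range f := fun j => by simp [s]
  let Y : Finset (Fin n) → SimpleGraph (Fin n) → ℝ := fun S G =>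
    Real.exp (-((∑ j ∈ S, ∑ l, (adjIndicator G j (f (l, false)) -
      adjIndicator G j (f (l, true))) ^ 2) / 4))
  -- The law of the graph is invariant under each swap, so the swaps may be averaged over.
  have hswap : ∀ η : Fin q → Fin n → Bool, μ.real A =
      ∑ G, μ.real {G} * if G.twist (swapPairs f η) ∈ A then 1 else 0 := by
    intro η
    have hs := fun a b => swapPairs_swapPairs η hf a b
    let Φ : Equiv.Perm (SimpleGraph (Fin n)) :=
      Function.Involutive.toPerm (SimpleGraph.twist (swapPairs f η))
        (SimpleGraph.twist_twist hs)
    have h1 : μ.real A = ∑ G, μ.real {G} * if G ∈ A then 1 else 0 := by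
      simp_rw [mul_ite, mul_one, mul_zero]
      rw [← Finset.sum_filter, sum_measureReal_singleton]
      simp
    rw [h1, ← Equiv.sum_comp Φ]
    refine Finset.sum_congr rfl fun G _ => ?_
    have h2 : μ.real {Φ G} = μ.real {G} := binomialRandom_real_singleton_twist p hs G
    rw [h2]
    rfl
  have havg : 2 ^ (n * q) * μ.real A = ∑ G, μ.real {G} * (Nat.card {η : Fin q → Fin n → Bool //
      IsDegenerateAt (Matrix.toEuclideanLin
        (graphLaplacian (G.twist (swapPairs f η)) + F)) f δ β d} : ℝ) := by
    have h1 : ∑ _η : Fin q → Fin n → Bool, μ.real A = 2 ^ (n * q) * μ.real A := by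
      rw [Finset.sum_const, Finset.card_univ, nsmul_eq_mul]
      simp [pow_mul]
    rw [← h1, Finset.sum_congr rfl fun η _ => hswap η, Finset.sum_comm]
    refine Finset.sum_congr rfl fun G _ => ?_
    rw [← Finset.mul_sum, Nat.card_eq_fintype_card, Fintype.card_subtype, Finset.card_filter,
      Nat.cast_sum]
    congr 1
    refine Finset.sum_congr rfl fun η _ => ?_
    rw [Nat.cast_ite, Nat.cast_one, Nat.cast_zero]
    rfl
  have hY : ∀ S ∈ s.powersetCard d, ∑ G, μ.real {G} * Y S G = κ ^ (d * q) := by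
    intro S hS
    obtain ⟨hSs, hSd⟩ := Finset.mem_powersetCard.1 hS
    have h1 := integral_exp_neg_discordance hf p S fun j hj => (hs j).1 (hSs hj)
    rw [integral_fintype .of_finite] at h1
    rw [hSd] at h1
    exact h1
  have h1 : 2 ^ (n * q) * μ.real A ≤ 2 ^ (n * q) * (Real.exp (8 * q * (δ * β) ^ 2) *
      (n ^ d * κ ^ (d * q))) := by
    rw [havg]
    calc _ ≤ ∑ G, μ.real {G} * (Real.exp (8 * q * (δ * β) ^ 2) *
          (2 ^ (n * q) * ∑ S ∈ s.powersetCard d, Y S G)) := by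
          refine Finset.sum_le_sum fun G _ => ?_
          gcongr
          exact card_isDegenerateAt_twist_le hf G F hδ s hs
      _ = 2 ^ (n * q) * (Real.exp (8 * q * (δ * β) ^ 2) *
          ∑ S ∈ s.powersetCard d, ∑ G, μ.real {G} * Y S G) := by
          rw [Finset.sum_comm, Finset.mul_sum, Finset.mul_sum]
          refine Finset.sum_congr rfl fun G _ => ?_
          rw [← Finset.mul_sum]
          ring
      _ ≤ _ := by
          rw [Finset.sum_congr rfl hY, Finset.sum_const, Finset.card_powersetCard, nsmul_eq_mul]
          gcongr
          have h2 : s.card ≤ n := by simpa using Finset.card_le_univ s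
          exact_mod_cast (Nat.choose_le_pow _ _).trans (Nat.pow_le_pow_left h2 d)
  exact le_of_mul_le_mul_left h1 (by positivity)

/-! ### Union bound over the pairs -/

theorem theorem2p6 (p : unitInterval) (hp0 : 0 < p) (hp1 : p < 1) :
    ∃ C c : ℝ, 1 ≤ C ∧ 0 < c ∧
      ∃ K a : ℝ, 0 < K ∧ 0 < a ∧
        ∀ n : ℕ, 2 ≤ n →
          ∀ k : ℕ, C * Real.log n ≤ k → k ≤ n →
            ∀ F : Matrix (Fin n) (Fin n) ℝ,
              (SimpleGraph.binomialRandom (Fin n) p).real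
                  {G | singularValue (graphLaplacian G + F) (n - k + 1) ≤ c * k / √(n : ℝ)} ≤
                K * Real.exp (-(a * ((k : ℝ) ^ (3 / 2 : ℝ) / Real.log n))) := by
  classical
  -- Each pair, seen from an outside vertex, contributes the factor `1 - κ` to the exponential
  -- moment of the discordances.
  set κ : ℝ := 2 * p * (1 - p) * (1 - Real.exp (-(1 / 4))) with hκ
  have hp0' : (0 : ℝ) < p := hp0
  have hp1' : (p : ℝ) < 1 := hp1
  have he1 : Real.exp (-(1 / 4)) < 1 := by rw [Real.exp_lt_one_iff]; norm_num
  have hκ0 : 0 < κ := mul_pos (mul_pos (by linarith) (by linarith)) (by linarith)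
  have hκ1 : κ ≤ 1 := by
    have h2 : 2 * (p : ℝ) * (1 - p) ≤ 1 := by nlinarith [sq_nonneg ((p : ℝ) - 1 / 2)]
    exact mul_le_one₀ h2 (by linarith) (by linarith [Real.exp_pos (-(1 / 4))])
  have hC : 64 ≤ 64 / κ := by rw [le_div_iff₀ hκ0]; linarith
  -- With `q ≤ k / 4` pairs and `q ≥ k / 8`, the gain is `2 κ q ^ 2`. The values of `C` and `c` make
  -- the entropy `4 q log n` and the small-ball cost each at most `κ q ^ 2 / 2`.
  refine ⟨64 / κ, √(κ / 256), by linarith, by positivity, 1, κ * Real.log 2 / 64, one_pos,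
    by have := Real.log_pos one_lt_two; positivity, ?_⟩
  intro n hn k hCk hkn F
  have hn2 : (2 : ℝ) ≤ n := by exact_mod_cast hn
  have hlog2 : 1 / 2 < Real.log 2 := by linarith [Real.log_two_gt_d9]
  have hlogn : Real.log 2 ≤ Real.log n := Real.log_le_log two_pos hn2
  have hk4 : 4 ≤ k := by
    have h1 : 64 * Real.log n ≤ 64 / κ * Real.log n := by gcongr
    have h2 : (4 : ℝ) ≤ k := by linarith
    exact_mod_cast h2
  obtain ⟨q, hq1, hqk, hkq⟩ : ∃ q : ℕ, 1 ≤ q ∧ 4 * q ≤ k ∧ k ≤ 8 * q :=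
    ⟨k / 4, by omega, by omega, by omega⟩
  have hkpos : (0 : ℝ) < k := by exact_mod_cast (by omega : 0 < k)
  have hnpos : (0 : ℝ) < n := by linarith
  have hqk' : 4 * (q : ℝ) ≤ k := by exact_mod_cast hqk
  have hkq' : (k : ℝ) ≤ 8 * q := by exact_mod_cast hkq
  set δ : ℝ := √(κ / 256) * k / √(n : ℝ) with hδ
  have hδ0 : 0 ≤ δ := by positivity
  set β : ℝ := √(2 * n / k) with hβ
  have hδβ : (δ * β) ^ 2 = κ * k / 128 := by
    rw [hδ, hβ, mul_pow, div_pow, mul_pow, Real.sq_sqrt (by positivity),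
      Real.sq_sqrt (by positivity), Real.sq_sqrt (by positivity)]
    field_simp
    ring
  let μ := SimpleGraph.binomialRandom (Fin n) p
  let B : (Fin q × Bool → Fin n) → Set (SimpleGraph (Fin n)) := fun f =>
    {G | Function.Injective f ∧
      IsDegenerateAt (Matrix.toEuclideanLin (graphLaplacian G + F)) f δ β (2 * q)}
  have hsub : {G | singularValue (graphLaplacian G + F) (n - k + 1) ≤ δ} ⊆ ⋃ f, B f := by
    intro G hG
    have hcard : Fintype.card (Fin q × Bool) = 2 * q := by simp [mul_comm]
    obtain ⟨f, hf, ⟨v, hvf, hTv, hvn⟩, W, hWd, hW0, hW⟩ :=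
      exists_dual_family_and_left_subspace (κ := Fin q × Bool)
        (Matrix.toEuclideanLin (graphLaplacian G + F)) (k := k) (δ := δ)
        (by simpa using hkn) (by rw [hcard]; omega) (by
          rw [Fintype.card_fin]
          simpa [singularValue] using hG)
    rw [hcard] at hWd
    refine Set.mem_iUnion.2 ⟨f, hf, ⟨v, hvf, hTv, fun a => ?_⟩, W, by omega, hW0, hW⟩
    have h1 := hvn a
    rw [hcard, Fintype.card_fin] at h1
    push_cast at h1
    refine Real.le_sqrt_of_sq_le ?_
    rw [le_div_iff₀ hkpos]
    nlinarith [sq_nonneg ‖v a‖]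
  have hB : ∀ f, μ.real (B f) ≤ Real.exp (8 * q * (δ * β) ^ 2) *
      (n ^ (2 * q) * (1 - κ) ^ (2 * q * q)) := by
    intro f
    by_cases hf : Function.Injective f
    · refine (measureReal_mono fun G hG => hG.2).trans
        (binomialRandom_real_isDegenerateAt_le hf p F hδ0)
    · have : B f = ∅ := Set.eq_empty_of_forall_notMem fun G hG => hf hG.1
      rw [this, measureReal_empty]
      have := sub_nonneg.2 hκ1
      positivity
  have hpown : (n : ℝ) ^ (2 * q) = Real.exp (2 * q * Real.log n) := by
    rw [← Real.exp_log (pow_pos hnpos _), Real.log_pow]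
    push_cast
    ring_nf
  have hpowκ : (1 - κ) ^ (2 * q * q) ≤ Real.exp (-(2 * q * q * κ)) := by
    have h1 : 1 - κ ≤ Real.exp (-κ) := by linarith [Real.add_one_le_exp (-κ)]
    refine (pow_le_pow_left₀ (sub_nonneg.2 hκ1) h1 _).trans_eq ?_
    rw [← Real.exp_nat_mul]
    push_cast
    ring_nf
  have hlogk : Real.log n ≤ κ * k / 64 := by
    rw [div_mul_eq_mul_div, div_le_iff₀ hκ0] at hCk
    rw [le_div_iff₀ (by norm_num)]
    linarith
  calc μ.real {G | singularValue (graphLaplacian G + F) (n - k + 1) ≤ δ}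
      ≤ ∑ f, μ.real (B f) := (measureReal_mono hsub).trans (measureReal_iUnion_fintype_le _)
    _ ≤ ∑ _f : Fin q × Bool → Fin n, Real.exp (8 * q * (δ * β) ^ 2) *
          (n ^ (2 * q) * (1 - κ) ^ (2 * q * q)) := Finset.sum_le_sum fun f _ => hB f
    _ = n ^ (2 * q) * (Real.exp (8 * q * (δ * β) ^ 2) *
          (n ^ (2 * q) * (1 - κ) ^ (2 * q * q))) := by
        rw [Finset.sum_const, Finset.card_univ, nsmul_eq_mul]
        simp [mul_comm]
    _ ≤ Real.exp (2 * q * Real.log n) * (Real.exp (8 * q * (δ * β) ^ 2) *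
          (Real.exp (2 * q * Real.log n) * Real.exp (-(2 * q * q * κ)))) := by
        rw [hpown]
        gcongr
    _ = Real.exp (4 * q * Real.log n + κ * q * k / 16 - 2 * κ * q ^ 2) := by
        rw [← Real.exp_add, ← Real.exp_add, ← Real.exp_add, hδβ]
        ring_nf
    _ ≤ Real.exp (-(κ * k ^ 2 / 64)) := by
        have hq0 : (0 : ℝ) < q := by exact_mod_cast hq1
        have h1 : 4 * q * Real.log n ≤ 4 * q * (κ * k / 64) := by gcongr
        have h2 : κ * q * k ≤ κ * q * (8 * q) := by gcongr
        have h3 : κ * k ^ 2 ≤ κ * (8 * q) ^ 2 := by gcongr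
        gcongr
        nlinarith
    _ ≤ 1 * Real.exp (-(κ * Real.log 2 / 64 * ((k : ℝ) ^ (3 / 2 : ℝ) / Real.log n))) := by
        rw [one_mul]
        have hk1 : (1 : ℝ) ≤ k := by exact_mod_cast (by omega : 1 ≤ k)
        have h1 : (k : ℝ) ^ (3 / 2 : ℝ) ≤ (k : ℝ) ^ 2 := by
          rw [← Real.rpow_natCast (k : ℝ) 2]
          exact Real.rpow_le_rpow_of_exponent_le hk1 (by norm_num)
        have h2 : Real.log 2 * ((k : ℝ) ^ (3 / 2 : ℝ) / Real.log n) ≤ (k : ℝ) ^ 2 := by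
          rw [mul_div_assoc', div_le_iff₀ (by linarith), mul_comm]
          gcongr
        gcongr
        calc _ = κ / 64 * (Real.log 2 * ((k : ℝ) ^ (3 / 2 : ℝ) / Real.log n)) := by ring
          _ ≤ κ / 64 * (k : ℝ) ^ 2 := by gcongr
          _ = _ := by ring
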